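/- Conventions. A $\mathbb{Z}_2$-manifold (supermanifold) $M=(|M|,\mathcal{O}_M)$ of dimension $m|n$ is a second-countable Hausdorff space with a sheaf of $\mathbb{Z}_2$-graded, $\mathbb{Z}_2$-commutative, associative unital $\mathbb{R}$-algebras with local stalks, locally isomorphic to $\mathbb{R}^{m|n}=(\mathbb{R}^m, C^\infty\otimes\Lambda\mathbb{R}^n)$. Write $\mathcal{T}M(U)=\mathrm{Der}(\mathcal{O}_M(U))$ for the $\mathbb{Z}_2$-graded derivations, $C^\infty(M)=\mathcal{O}_M(|M|)$, $\mathrm{Vect}(M)=\mathcal{T}M(|M|)$, $|\cdot|\in\mathbb{Z}_2$ for degrees, and $[X,Y]=XY-(-1)^{|X||Y|}YX$. A Riemannian metric $g=\langle -,-\rangle_g$ is a morphism of sheaves $\mathcal{T}M\otimes\mathcal{T}M\to\mathcal{O}_M$, homogeneous of a degree $|g|\in\mathbb{Z}_2$ (so $|\langle X,Y\rangle_g|=|X|+|Y|+|g|$), with $\langle X,Y\rangle_g=(-1)^{|X||Y|}\langle Y,X\rangle_g$ and $\langle fX,Y\rangle_g=f\langle X,Y\rangle_g$, which is non-degenerate,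 i.e. $Y\mapsto\langle -,Y\rangle_g$ is a bijection from $\mathcal{T}M$ onto its $\mathcal{O}_M$-linear dual (over every open set). An affine connection is a bi-additive, degree-preserving map $\nabla:\mathrm{Vect}(M)\times\mathrm{Vect}(M)\to\mathrm{Vect}(M)$ with $\nabla_{fX}Y=f\nabla_XY$ and $\nabla_X(fY)=X(f)Y+(-1)^{|X||f|}f\nabla_XY$. Its torsion is $T_\nabla(X,Y)=\nabla_XY-(-1)^{|X||Y|}\nabla_YX-[X,Y]$, and it is metric compatible if $X\langle Y,Z\rangle_g=\langle\nabla_XY,Z\rangle_g+(-1)^{|X||Y|}\langle Y,\nabla_XZ\rangle_g$. The Levi-Civita connection $\nabla^L$ is the affine connection that is torsion-free and metric compatible. Put $X\cdot f=(-1)^{|X||f|}fX$. Formulas containing degrees are for homogeneous arguments. Theorem. Let $(M,g)$ be a Riemannian $\mathbb{Z}_2$-manifold and let $P\in\mathrm{Vect}(M)$ be homogeneous with $|P|=|g|$. There is exactly one affine connection $\nabla$ on $M$ such that, for all homogeneous $X,Y,Z\in\mathrm{Vect}(M)$, $$T_{\nabla}(X,Y)=X\cdot g(Y,P)-(-1)^{|X||Y|}\,Y\cdot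 g(X,P),$$ $$\langle\nabla_XY,Z\rangle_g+(-1)^{|X||Y|}\langle Y,\nabla_XZ\rangle_g = X\langle Y,Z\rangle_g+(-1)^{|X||Y|}g(Y,P)g(X,Z)+(-1)^{|X||Y|}(-1)^{|Z|(|X|+|Y|)}g(Z,P)g(Y,X).$$ An affine connection satisfies these two conditions if and only if it is the semi-symmetric non-metric connection $\widehat\nabla$, given by $\widehat{\nabla}_XY=\nabla^L_XY+X\cdot g(Y,P)$ for homogeneous $X,Y$. If $P\neq 0$, this connection is not metric compatible. -/

import Mathlib

open CategoryTheory Opposite TopologicalSpace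
open scoped Manifold ContDiff TensorProduct

universe u

noncomputable section

namespace SuperGeometry

/-! ### Supercommutative real algebras and their superderivations -/

/-- The sign `(-1)^{i j}` for parities `i, j ∈ ℤ/2`. -/
def sgn (i j : ZMod 2) : ℤ := (-1) ^ (i.val * j.val)

/-- `A = A₀ ⊕ A₁` is a `ℤ/2`-graded, `ℤ/2`-commutative, associative unital real algebra. -/
class SuperCommAlg {A : Type u} [Ring A] [Algebra ℝ A] (𝒜 : ZMod 2 → Submodule ℝ A) : Prop
    extends SetLike.GradedMonoid 𝒜 where
  isInternal : DirectSum.IsInternal 𝒜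
  super_comm : ∀ (i j : ZMod 2), ∀ a ∈ 𝒜 i, ∀ b ∈ 𝒜 j, a * b = sgn i j • (b * a)

section Derivations

variable {A : Type u} [Ring A] [Algebra ℝ A] (𝒜 : ZMod 2 → Submodule ℝ A)

/-- The superderivations of `A` that are homogeneous of degree `i`. -/
def derDeg (i : ZMod 2) : Submodule ℝ (A →ₗ[ℝ] A) where
  carrier := {D | (∀ j, ∀ a ∈ 𝒜 j, D a ∈ 𝒜 (i + j)) ∧
    ∀ j, ∀ a ∈ 𝒜 j, ∀ b, D (a * b) = D a * b + sgn i j • (a * D b)}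
  zero_mem' := by simp
  add_mem' := by
    rintro D E ⟨hD, hD'⟩ ⟨hE, hE'⟩
    refine ⟨fun j a ha => add_mem (hD j a ha) (hE j a ha), fun j a ha b => ?_⟩
    simp only [LinearMap.add_apply, hD' j a ha, hE' j a ha, mul_add, add_mul, smul_add]
    abel
  smul_mem' := by
    rintro c D ⟨hD, hD'⟩
    refine ⟨fun j a ha => Submodule.smul_mem _ _ (hD j a ha), fun j a ha b => ?_⟩
    simp only [LinearMap.smul_apply, hD' j a ha, smul_add, smul_mul_assoc, mul_smul_comm]
    rw [smul_comm c (sgn i j)]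

variable {𝒜}

lemma sgn_add_left (i j k : ZMod 2) : sgn (i + j) k = sgn i k * sgn j k := by
  revert i j k; decide

lemma sgn_add_right (i j k : ZMod 2) : sgn i (j + k) = sgn i j * sgn i k := by
  revert i j k; decide

lemma sgn_comm (i j : ZMod 2) : sgn i j = sgn j i := by
  revert i j; decide

lemma sgn_mul_self (i j : ZMod 2) : sgn i j * sgn i j = 1 := by
  revert i j; decide

lemma smul_mem_derDeg [SuperCommAlg 𝒜] {i j : ZMod 2} {f : A} (hf : f ∈ 𝒜 i)
    {D : A →ₗ[ℝ] A} (hD : D ∈ derDeg 𝒜 j) : f • D ∈ derDeg 𝒜 (i + j) := by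
  refine ⟨fun k a ha => ?_, fun k a ha b => ?_⟩
  · have := SetLike.GradedMul.mul_mem hf (hD.1 k a ha)
    simpa [add_assoc] using this
  · have hc : f * a = sgn i k • (a * f) := SuperCommAlg.super_comm i k f hf a ha
    simp only [LinearMap.smul_apply, smul_eq_mul, hD.2 k a ha b, mul_add, mul_smul_comm,
      ← mul_assoc, hc, smul_mul_assoc, smul_smul, sgn_add_left]
    rw [mul_comm (sgn j k)]

lemma exists_add_of_internal [SuperCommAlg 𝒜] (f : A) :
    ∃ f₀ ∈ 𝒜 0, ∃ f₁ ∈ 𝒜 1, f = f₀ + f₁ := by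
  have h : f ∈ ⨆ i, 𝒜 i := by
    rw [(SuperCommAlg.isInternal (𝒜 := 𝒜)).submodule_iSup_eq_top]; trivial
  have h2 : (⨆ i, 𝒜 i) ≤ 𝒜 0 ⊔ 𝒜 1 := by
    refine iSup_le fun i => ?_
    fin_cases i
    · exact le_sup_left
    · exact le_sup_right
  obtain ⟨a, ha, b, hb, rfl⟩ := Submodule.mem_sup.1 (h2 h)
  exact ⟨a, ha, b, hb, rfl⟩

variable (𝒜) in
/-- `Der(A) = Der(A)₀ ⊕ Der(A)₁`, as a left `A`-module via `(f D)(h) = f · D(h)`. -/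
def der [SuperCommAlg 𝒜] : Submodule A (A →ₗ[ℝ] A) where
  carrier := {D | ∃ D₀ ∈ derDeg 𝒜 0, ∃ D₁ ∈ derDeg 𝒜 1, D = D₀ + D₁}
  zero_mem' := ⟨0, zero_mem _, 0, zero_mem _, by simp⟩
  add_mem' := by
    rintro _ _ ⟨D₀, h₀, D₁, h₁, rfl⟩ ⟨E₀, k₀, E₁, k₁, rfl⟩
    exact ⟨_, add_mem h₀ k₀, _, add_mem h₁ k₁, by abel⟩
  smul_mem' := by
    rintro f _ ⟨D₀, h₀, D₁, h₁, rfl⟩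
    obtain ⟨f₀, hf₀, f₁, hf₁, rfl⟩ := exists_add_of_internal (𝒜 := 𝒜) f
    refine ⟨f₀ • D₀ + f₁ • D₁, add_mem ?_ ?_, f₀ • D₁ + f₁ • D₀, add_mem ?_ ?_, ?_⟩
    · simpa using smul_mem_derDeg hf₀ h₀
    · exact smul_mem_derDeg hf₁ h₁
    · simpa using smul_mem_derDeg hf₀ h₁
    · simpa using smul_mem_derDeg hf₁ h₀
    · simp only [add_smul, smul_add]; abel

lemma derDeg_le_der [SuperCommAlg 𝒜] {i : ZMod 2} {D : A →ₗ[ℝ] A} (hD : D ∈ derDeg 𝒜 i) :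
    D ∈ der 𝒜 := by
  fin_cases i
  · exact ⟨D, hD, 0, zero_mem _, by simp⟩
  · exact ⟨0, zero_mem _, D, hD, by simp⟩

/-- The supercommutator of homogeneous superderivations is a superderivation. -/
lemma bracket_mem_derDeg {i j : ZMod 2} {X Y : A →ₗ[ℝ] A}
    (hX : X ∈ derDeg 𝒜 i) (hY : Y ∈ derDeg 𝒜 j) :
    X ∘ₗ Y - sgn i j • (Y ∘ₗ X) ∈ derDeg 𝒜 (i + j) := by
  refine ⟨fun k a ha => ?_, fun k a ha b => ?_⟩
  · have h1 := hX.1 _ _ (hY.1 k a ha)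
    have h2 := hY.1 _ _ (hX.1 k a ha)
    rw [add_left_comm j i k] at h2
    rw [add_assoc]
    exact sub_mem h1 (zsmul_mem h2 _)
  · simp only [LinearMap.sub_apply, LinearMap.comp_apply, LinearMap.smul_apply, hX.2 k a ha b,
      hY.2 k a ha b, map_add, map_zsmul, hX.2 _ _ (hY.1 k a ha), hY.2 _ _ (hX.1 k a ha),
      hX.2 k a ha, hY.2 k a ha, sgn_add_left, sgn_add_right, sub_mul, mul_sub, smul_mul_assoc,
      mul_smul_comm, smul_add, smul_sub, smul_smul]
    have e1 : sgn i j * (sgn j i * sgn j k) = sgn j k := by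
      rw [sgn_comm j i, ← mul_assoc, sgn_mul_self, one_mul]
    have e2 : sgn i j * (sgn i k * sgn j k) = sgn i k * sgn j k * sgn i j := by ring
    rw [e1, e2, mul_comm (sgn j k) (sgn i k)]
    abel

end Derivations

/-! ### Locally `ℤ/2`-ringed spaces and supermanifolds -/

/-- A locally `ℤ/2`-ringed space: a second-countable Hausdorff space with a sheaf of `ℤ/2`-graded
`ℤ/2`-commutative associative unital real algebras whose stalks are local rings. -/
structure SuperRingedSpace where
  carrier : TopCat.{u}
  [t2 : T2Space carrier]
  [secondCountable : SecondCountableTopology carrier]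
  sheaf : TopCat.Sheaf (AlgCat.{u} ℝ) carrier
  /-- the even and odd sections over `U` -/
  gr : ∀ U : Opens carrier, ZMod 2 → Submodule ℝ (sheaf.presheaf.obj (op U))
  [superComm : ∀ U, SuperCommAlg (gr U)]
  map_gr : ∀ {U V : Opens carrier} (h : V ≤ U) (i : ZMod 2), ∀ f ∈ gr U i,
    (sheaf.presheaf.map (homOfLE h).op).hom f ∈ gr V i
  local_stalk : ∀ p : carrier,
    IsLocalRing (TopCat.Presheaf.stalk (C := RingCat.{u})
      (sheaf.presheaf ⋙ forget₂ (AlgCat.{u} ℝ) RingCat.{u}) p : RingCat.{u})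

attribute [instance] SuperRingedSpace.superComm

namespace SuperRingedSpace

variable (M : SuperRingedSpace.{u})

/-- The algebra of sections of the structure sheaf over `U`. -/
abbrev sec (U : Opens M.carrier) : Type u := M.sheaf.presheaf.obj (op U)

/-- Restriction of sections. -/
def res {U V : Opens M.carrier} (h : V ≤ U) : M.sec U →ₐ[ℝ] M.sec V :=
  (M.sheaf.presheaf.map (homOfLE h).op).hom

/-- Sections over `U` of the tangent sheaf: the superderivations of the algebra of sections
over `U`. -/
abbrev tangent (U : Opens M.carrier) : Type u := der (M.gr U)

/-- `X'` on `V` is the restriction of `X` on `U`. -/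
def IsRestriction {U V : Opens M.carrier} (h : V ≤ U) (X : M.tangent U) (X' : M.tangent V) :
    Prop :=
  ∀ f : M.sec U, X'.1 (M.res h f) = M.res h (X.1 f)

/-- The algebra of global functions. -/
abbrev Fn : Type u := M.sec ⊤

/-- The module of vector fields. -/
abbrev Vect : Type u := M.tangent ⊤

/-- `f` is a global function of degree `i`. -/
def FnDeg (i : ZMod 2) (f : M.Fn) : Prop := f ∈ M.gr ⊤ i

variable {M}

/-- The vector field (more generally, section of the tangent sheaf) `X` is of degree `i`. -/
def HasDeg {U : Opens M.carrier} (i : ZMod 2) (X : M.tangent U) : Prop := X.1 ∈ derDeg (M.gr U) i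

/-- The bracket `[X, Y] = X ∘ Y - (-1)^{|X||Y|} Y ∘ X` of homogeneous vector fields. -/
def bracket {i j : ZMod 2} {X Y : M.Vect} (hX : HasDeg i X) (hY : HasDeg j Y) : M.Vect :=
  ⟨X.1 ∘ₗ Y.1 - sgn i j • (Y.1 ∘ₗ X.1), derDeg_le_der (bracket_mem_derDeg hX hY)⟩

end SuperRingedSpace

/-- The coordinate space underlying `ℝ^{m|n}`. -/
abbrev E (m : ℕ) : Type := EuclideanSpace ℝ (Fin m)

/-- Sections over `W ⊆ ℝ^m` of the structure sheaf of `ℝ^{m|n}`: `C^∞(W) ⊗ Λ ℝ^n`. -/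
abbrev Model (m n : ℕ) (W : Opens (E m)) : Type :=
  C^∞⟮𝓘(ℝ, E m), W; ℝ⟯ ⊗[ℝ] ExteriorAlgebra ℝ (Fin n → ℝ)

/-- Restriction of smooth functions, as a homomorphism of algebras. -/
def smoothRes {m : ℕ} {V W : Opens (E m)} (h : V ≤ W) :
    C^∞⟮𝓘(ℝ, E m), W; ℝ⟯ →ₐ[ℝ] C^∞⟮𝓘(ℝ, E m), V; ℝ⟯ :=
  { ContMDiffMap.restrictRingHom 𝓘(ℝ, E m) 𝓘(ℝ) ℝ h with
    commutes' := fun _ => rfl }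

/-- Restriction of sections of the structure sheaf of `ℝ^{m|n}`. -/
def modelRes {m : ℕ} (n : ℕ) {V W : Opens (E m)} (h : V ≤ W) : Model m n W →ₐ[ℝ] Model m n V :=
  Algebra.TensorProduct.map (smoothRes h) (AlgHom.id ℝ _)

/-- The degree `i` part of `C^∞(W) ⊗ Λ ℝ^n` is `C^∞(W) ⊗ (Λ ℝ^n)_i`. -/
def modelGr (m n : ℕ) (W : Opens (E m)) (i : ZMod 2) : Submodule ℝ (Model m n W) :=
  LinearMap.range (LinearMap.lTensor C^∞⟮𝓘(ℝ, E m), W; ℝ⟯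
    (CliffordAlgebra.evenOdd (0 : QuadraticForm ℝ (Fin n → ℝ)) i).subtype)

/-- A superchart: a homeomorphism of an open subset of `|M|` with an open subset of `ℝ^m`, together
with an isomorphism of the restricted structure sheaves. -/
structure SuperChart (M : SuperRingedSpace.{u}) (m n : ℕ) where
  toHomeo : OpenPartialHomeomorph M.carrier (E m)
  iso : ∀ W : Opens (E m), (W : Set (E m)) ⊆ toHomeo.target →
    Model m n W ≃ₐ[ℝ]
      M.sec ⟨toHomeo.source ∩ toHomeo ⁻¹' W, toHomeo.isOpen_inter_preimage W.isOpen⟩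
  iso_gr : ∀ (W : Opens (E m)) (hW : (W : Set (E m)) ⊆ toHomeo.target) (i : ZMod 2),
    ∀ f ∈ modelGr m n W i, iso W hW f ∈ M.gr _ i
  iso_res : ∀ (V W : Opens (E m)) (h : V ≤ W) (hW : (W : Set (E m)) ⊆ toHomeo.target)
    (f : Model m n W),
    iso V (Set.Subset.trans h hW) (modelRes n h f) =
      M.res (Set.inter_subset_inter_right _ (Set.preimage_mono h)) (iso W hW f)

/-- A supermanifold (`ℤ/2`-manifold) of dimension `m|n`: a locally `ℤ/2`-ringed space that is
locally isomorphic to `ℝ^{m|n}`. -/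
structure SuperManifold (m n : ℕ) extends SuperRingedSpace.{u} where
  exists_chart : ∀ p : carrier,
    ∃ c : SuperChart toSuperRingedSpace m n, p ∈ c.toHomeo.source

open SuperRingedSpace

/-! ### Riemannian metrics -/

/-- A Riemannian metric: a homogeneous, `ℤ/2`-symmetric, non-degenerate, linear morphism of sheaves
`TM ⊗ TM → O_M`. -/
structure SuperMetric {m n : ℕ} (M : SuperManifold.{u} m n) where
  /-- the degree `|g|` -/
  deg : ZMod 2
  /-- the form `⟨X, Y⟩` on sections over `U` -/
  form : ∀ U : Opens M.carrier, M.tangent U →+ M.tangent U →+ M.sec U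
  form_deg : ∀ U (i j : ZMod 2) (X Y : M.tangent U), HasDeg i X → HasDeg j Y →
    form U X Y ∈ M.gr U (i + j + deg)
  form_symm : ∀ U (i j : ZMod 2) (X Y : M.tangent U), HasDeg i X → HasDeg j Y →
    form U X Y = sgn i j • form U Y X
  form_smul : ∀ U (f : M.sec U) (X Y : M.tangent U), form U (f • X) Y = f * form U X Y
  form_res : ∀ {U V : Opens M.carrier} (h : V ≤ U) (X Y : M.tangent U) (X' Y' : M.tangent V),
    M.IsRestriction h X X' → M.IsRestriction h Y Y' → form V X' Y' = M.res h (form U X Y)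
  /-- Non-degeneracy: the metric identifies the tangent sheaf with its dual, that is, over every
  open set each linear form on the vector fields is `⟨-, Y⟩` for exactly one `Y`. -/
  nondegenerate : ∀ U (α : M.tangent U →ₗ[M.sec U] M.sec U),
    ∃! Y : M.tangent U, ∀ X, form U X Y = α X

/-- The metric `⟨X, Y⟩_g = g(X, Y)` on global vector fields. -/
abbrev SuperMetric.inner {m n : ℕ} {M : SuperManifold.{u} m n} (g : SuperMetric M)
    (X Y : M.Vect) : M.Fn :=
  g.form ⊤ X Y

/-! ### Affine connections -/

/-- An affine connection on a supermanifold. -/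
@[ext]
structure AffineConnection {m n : ℕ} (M : SuperManifold.{u} m n) where
  /-- the bi-additive map `(X, Y) ↦ ∇_X Y` -/
  nabla : M.Vect →+ M.Vect →+ M.Vect
  nabla_deg : ∀ (i j : ZMod 2) (X Y : M.Vect), HasDeg i X → HasDeg j Y →
    HasDeg (i + j) (nabla X Y)
  smul_left : ∀ (f : M.Fn) (X Y : M.Vect), nabla (f • X) Y = f • nabla X Y
  leibniz : ∀ (i j : ZMod 2) (f : M.Fn) (X Y : M.Vect), HasDeg i X → M.FnDeg j f →
    nabla X (f • Y) = X.1 f • Y + sgn i j • f • nabla X Y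

namespace AffineConnection

variable {m n : ℕ} {M : SuperManifold.{u} m n}

/-- The torsion `T(X, Y) = ∇_X Y - (-1)^{|X||Y|} ∇_Y X - [X, Y]` on homogeneous vector fields. -/
def torsion (D : AffineConnection M) {i j : ZMod 2} {X Y : M.Vect} (hX : HasDeg i X)
    (hY : HasDeg j Y) : M.Vect :=
  D.nabla X Y - sgn i j • D.nabla Y X - bracket hX hY

/-- `D` is symmetric: its torsion vanishes. -/
def IsSymmetric (D : AffineConnection M) : Prop :=
  ∀ (i j : ZMod 2) (X Y : M.Vect) (hX : HasDeg i X) (hY : HasDeg j Y), D.torsion hX hY = 0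

/-- `X⟨Y, Z⟩ = ⟨∇_X Y, Z⟩ + (-1)^{|X||Y|} ⟨Y, ∇_X Z⟩`. -/
def MetricCompatible (D : AffineConnection M) (g : SuperMetric M) : Prop :=
  ∀ (i j : ZMod 2) (X Y Z : M.Vect), HasDeg i X → HasDeg j Y →
    X.1 (g.inner Y Z) = g.inner (D.nabla X Y) Z + sgn i j • g.inner Y (D.nabla X Z)

/-- `D` is the Levi-Civita connection of `g`. -/
def IsLeviCivita (D : AffineConnection M) (g : SuperMetric M) : Prop :=
  D.IsSymmetric ∧ D.MetricCompatible g

end AffineConnection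

/-- The right multiplication `X · f = (-1)^{|X||f|} f X`, for `|X| = i` and `|f| = j`. -/
def rightMul {M : SuperRingedSpace.{u}} (i j : ZMod 2) (X : M.Vect) (f : M.Fn) : M.Vect :=
  sgn i j • f • X

namespace AffineConnection

variable {m n : ℕ} {M : SuperManifold.{u} m n}

/-- `D` is the semi-symmetric non-metric connection of `g` and `P`, that is,
`D_X Y = ∇^L_X Y + X · g(Y, P)` for homogeneous `X, Y`, where `∇^L` is the Levi-Civita connection.
As `|P| = |g|`, the function `g(Y, P)` has the degree of `Y`. -/
def IsSemiSymmetricNonMetric (D : AffineConnection M) (g : SuperMetric M) (P : M.Vect) : Prop :=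
  ∃ L : AffineConnection M, L.IsLeviCivita g ∧
    ∀ (i j : ZMod 2) (X Y : M.Vect), HasDeg i X → HasDeg j Y →
      D.nabla X Y = L.nabla X Y + rightMul i j X (g.inner Y P)

/-- The semi-symmetric torsion `T(X, Y) = X · g(Y, P) - (-1)^{|X||Y|} Y · g(X, P)`. -/
def HasSemiSymmetricTorsion (D : AffineConnection M) (g : SuperMetric M) (P : M.Vect) : Prop :=
  ∀ (i j : ZMod 2) (X Y : M.Vect) (hX : HasDeg i X) (hY : HasDeg j Y),
    D.torsion hX hY =
      rightMul i j X (g.inner Y P) - sgn i j • rightMul j i Y (g.inner X P)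

/-- The prescribed non-metricity
`⟨∇_X Y, Z⟩ + (-1)^{|X||Y|} ⟨Y, ∇_X Z⟩
  = X⟨Y, Z⟩ + (-1)^{|X||Y|} g(Y, P) g(X, Z) + (-1)^{|X||Y|} (-1)^{|Z|(|X|+|Y|)} g(Z, P) g(Y, X)`. -/
def HasNonMetricity (D : AffineConnection M) (g : SuperMetric M) (P : M.Vect) : Prop :=
  ∀ (i j k : ZMod 2) (X Y Z : M.Vect), HasDeg i X → HasDeg j Y → HasDeg k Z →
    g.inner (D.nabla X Y) Z + sgn i j • g.inner Y (D.nabla X Z) =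
      X.1 (g.inner Y Z) + sgn i j • (g.inner Y P * g.inner X Z) +
        (sgn i j * sgn k (i + j)) • (g.inner Z P * g.inner Y X)

end AffineConnection

end SuperGeometry

end

noncomputable section

namespace SuperGeometry

/-! ### Parities and homogeneous parts -/

/-! The tensor `B(X, Y) = X · g(Y, P)` has degree 0 because `|P| = |g|`. It is `O`-linear in `X` and
graded linear in `Y`, so `D ↦ D - B` is a bijection of the affine connections onto themselves. Under
it the prescribed torsion of `D` becomes vanishing torsion of `D - B`, since the right-hand side is
the graded antisymmetrisation of `B`. The prescribed non-metricity becomes metric compatibility,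
since the two extra terms are `⟨B(X, Y), Z⟩` and `(-1)^{|X||Y|} ⟨Y, B(X, Z)⟩` (`hasSemiTorsion_iff`,
`hasSemiNonMetricity_iff`). Existence, uniqueness and the characterisation therefore reduce to the
fundamental theorem of Riemannian geometry. Its existence half is the graded Koszul formula
(`exists_leviCivita`). Its uniqueness half says that a tensor symmetric in two slots and skew in the
other two vanishes (`symm_skew_eq_zero`). This part is pure algebra over `C^∞(M)` and uses only
global sections.

Suppose now that such a `D` were also metric compatible. Then the two extra terms cancel, and
non-degeneracy turns this into `g(Y, P) Z + (-1)^{|Y||Z|} g(Z, P) Y = 0` for all homogeneous `Y`,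
`Z` (`smul_add_smul_eq_zero`). It remains to show `g(Y, P) = 0` near each point; then `g(-, P) = 0`
and `P = 0`. With an even coordinate `x`, taking `Y = Z = ∂/∂x` gives `2 g(∂/∂x, P) = 0`, and then
`Z = ∂/∂x` gives `g(Y, P) = 0`. With no even and at least two odd coordinates, `∂/∂θ¹` and `∂/∂θ²`
play this role. In dimension `0|1` the identity for `Y = Z = ∂/∂θ` is empty, but a graded symmetric
form satisfies `g(∂/∂θ, ∂/∂θ) = 0` and `∂/∂θ` spans the derivations. In dimension `0|0` there are no
derivations.

The identity concerns global vector fields, so coordinate fields and functions must be made global: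
they are multiplied by a bump function and extended by zero through the sheaf axiom
(`LocalExtension`). -/

lemma parity_cases (i : ZMod 2) : i = 0 ∨ i = 1 := by
  revert i; decide

lemma parity_one_add_one : (1 : ZMod 2) + 1 = 0 := by decide

lemma sgn_zero_left (i : ZMod 2) : sgn 0 i = 1 := by
  revert i; decide

lemma sgn_zero_right (i : ZMod 2) : sgn i 0 = 1 := by
  revert i; decide

lemma sgn_one_one : sgn 1 1 = -1 := by decide

section Parts

variable {A : Type u} [Ring A] [Algebra ℝ A] {𝒜 : ZMod 2 → Submodule ℝ A}

lemma eq_zero_of_mem_of_mem [SuperCommAlg 𝒜] {i j : ZMod 2} (hij : i ≠ j) {a : A}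
    (hi : a ∈ 𝒜 i) (hj : a ∈ 𝒜 j) : a = 0 :=
  Submodule.disjoint_def.1
    ((SuperCommAlg.isInternal (𝒜 := 𝒜)).submodule_iSupIndep.pairwiseDisjoint hij) a hi hj

/-- On a homogeneous element such a derivation takes values in two different degrees at once, and
homogeneous elements span. -/
lemma derDeg_eq_zero_of_mem_of_mem [SuperCommAlg 𝒜] {i j : ZMod 2} (hij : i ≠ j)
    {D : A →ₗ[ℝ] A} (hi : D ∈ derDeg 𝒜 i) (hj : D ∈ derDeg 𝒜 j) : D = 0 := by
  ext a
  obtain ⟨a₀, h₀, a₁, h₁, rfl⟩ := exists_add_of_internal (𝒜 := 𝒜) a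
  rw [map_add, eq_zero_of_mem_of_mem (𝒜 := 𝒜) (by simpa using hij) (hi.1 _ _ h₀) (hj.1 _ _ h₀),
    eq_zero_of_mem_of_mem (𝒜 := 𝒜) (by simpa using hij) (hi.1 _ _ h₁) (hj.1 _ _ h₁)]
  simp

variable [SuperCommAlg 𝒜]

lemma exists_parts (X : der 𝒜) :
    ∃ F : ZMod 2 → der 𝒜, (∀ i, (F i).1 ∈ derDeg 𝒜 i) ∧ X = F 0 + F 1 := by
  obtain ⟨X, D₀, h₀, D₁, h₁, rfl⟩ := X
  refine ⟨fun i => if i = 0 then ⟨D₀, derDeg_le_der h₀⟩ else ⟨D₁, derDeg_le_der h₁⟩,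
    fun i => ?_, ?_⟩
  · rcases parity_cases i with rfl | rfl
    · simpa using h₀
    · simpa using h₁
  · ext; simp

lemma parts_unique {F G : ZMod 2 → der 𝒜} (hF : ∀ i, (F i).1 ∈ derDeg 𝒜 i)
    (hG : ∀ i, (G i).1 ∈ derDeg 𝒜 i) (h : F 0 + F 1 = G 0 + G 1) : F = G := by
  have h' : (F 0).1 - (G 0).1 = (G 1).1 - (F 1).1 :=
    sub_eq_sub_iff_add_eq_add.2 ((congrArg Subtype.val h).trans (add_comm _ _))
  have h0 : (F 0).1 - (G 0).1 ∈ derDeg 𝒜 0 := sub_mem (hF 0) (hG 0)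
  have h1 : (F 0).1 - (G 0).1 ∈ derDeg 𝒜 1 := h' ▸ sub_mem (hG 1) (hF 1)
  have h2 := derDeg_eq_zero_of_mem_of_mem (by decide) h0 h1
  funext i
  rcases parity_cases i with rfl | rfl
  · exact Subtype.ext (sub_eq_zero.1 h2)
  · exact Subtype.ext (sub_eq_zero.1 (h'.symm.trans h2)).symm

/-- The homogeneous part of degree `i` of a superderivation. -/
def homPart (i : ZMod 2) : der 𝒜 →+ der 𝒜 where
  toFun X := (exists_parts X).choose i
  map_zero' := congrFun (parts_unique (exists_parts 0).choose_spec.1 (G := fun _ => 0)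
    (fun _ => zero_mem _) (by rw [← (exists_parts (0 : der 𝒜)).choose_spec.2]; simp)) i
  map_add' X Y := congrFun (parts_unique (exists_parts (X + Y)).choose_spec.1
    (G := fun i => (exists_parts X).choose i + (exists_parts Y).choose i)
    (fun i => add_mem ((exists_parts X).choose_spec.1 i) ((exists_parts Y).choose_spec.1 i))
    (by
      rw [← (exists_parts (X + Y)).choose_spec.2, add_add_add_comm,
        ← (exists_parts X).choose_spec.2, ← (exists_parts Y).choose_spec.2])) i

lemma homPart_mem (i : ZMod 2) (X : der 𝒜) : (homPart i X).1 ∈ derDeg 𝒜 i :=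
  (exists_parts X).choose_spec.1 i

lemma homPart_add (X : der 𝒜) : homPart 0 X + homPart 1 X = X :=
  (exists_parts X).choose_spec.2.symm

lemma homPart_of_mem {i : ZMod 2} {X : der 𝒜} (hX : X.1 ∈ derDeg 𝒜 i) (j : ZMod 2) :
    homPart j X = if j = i then X else 0 := by
  refine congrFun (parts_unique (F := fun j => homPart j X) (fun j => homPart_mem j X)
    (G := fun j => if j = i then X else 0) (fun j => ?_) ?_) j
  · split_ifs with h
    · exact h ▸ hX
    · exact zero_mem _
  · rw [homPart_add]
    rcases parity_cases i with rfl | rfl <;> simp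

/-- Additive maps on superderivations agree as soon as they agree on homogeneous elements. -/
lemma addHom_ext_of_homogeneous {C : Type*} [AddCommGroup C] {F G : der 𝒜 →+ C}
    (h : ∀ i X, X.1 ∈ derDeg 𝒜 i → F X = G X) : F = G := by
  ext X
  rw [← homPart_add X, map_add, map_add, h 0 _ (homPart_mem 0 X), h 1 _ (homPart_mem 1 X)]

end Parts

/-! ### Metrics on the module of superderivations -/

section Metric

variable {A : Type u} [Ring A] [Algebra ℝ A] (𝒜 : ZMod 2 → Submodule ℝ A) [SuperCommAlg 𝒜]

/-- A homogeneous, graded symmetric, non-degenerate bilinear form on superderivations. -/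
structure IsSuperMetric (d : ZMod 2) (g : der 𝒜 →+ der 𝒜 →+ A) : Prop where
  deg : ∀ (i j : ZMod 2) (X Y : der 𝒜), X.1 ∈ derDeg 𝒜 i → Y.1 ∈ derDeg 𝒜 j →
    g X Y ∈ 𝒜 (i + j + d)
  symm : ∀ (i j : ZMod 2) (X Y : der 𝒜), X.1 ∈ derDeg 𝒜 i → Y.1 ∈ derDeg 𝒜 j →
    g X Y = sgn i j • g Y X
  smul : ∀ (f : A) (X Y : der 𝒜), g (f • X) Y = f * g X Y
  nondegenerate : ∀ α : der 𝒜 →ₗ[A] A, ∃! Y : der 𝒜, ∀ X, g X Y = α X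

variable {𝒜}

/-- The bracket of the parts of degrees `i` and `j` of two superderivations. -/
def partBracket (i j : ZMod 2) (X Y : der 𝒜) : der 𝒜 :=
  ⟨(homPart i X).1 ∘ₗ (homPart j Y).1 - sgn i j • ((homPart j Y).1 ∘ₗ (homPart i X).1),
    derDeg_le_der (bracket_mem_derDeg (homPart_mem i X) (homPart_mem j Y))⟩

lemma partBracket_mem (i j : ZMod 2) (X Y : der 𝒜) :
    (partBracket i j X Y).1 ∈ derDeg 𝒜 (i + j) :=
  bracket_mem_derDeg (homPart_mem i X) (homPart_mem j Y)

lemma partBracket_add_left (i j : ZMod 2) (X X' Y : der 𝒜) :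
    partBracket i j (X + X') Y = partBracket i j X Y + partBracket i j X' Y := by
  ext a
  simp [partBracket]
  abel

lemma partBracket_add_right (i j : ZMod 2) (X Y Y' : der 𝒜) :
    partBracket i j X (Y + Y') = partBracket i j X Y + partBracket i j X Y' := by
  ext a
  simp [partBracket]
  abel

lemma partBracket_apply {i j : ZMod 2} {X Y : der 𝒜} (hX : X.1 ∈ derDeg 𝒜 i)
    (hY : Y.1 ∈ derDeg 𝒜 j) (a : A) :
    (partBracket i j X Y).1 a = X.1 (Y.1 a) - sgn i j • Y.1 (X.1 a) := by
  simp [partBracket, homPart_of_mem hX, homPart_of_mem hY]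

lemma partBracket_swap {i j : ZMod 2} {X Y : der 𝒜} (hX : X.1 ∈ derDeg 𝒜 i)
    (hY : Y.1 ∈ derDeg 𝒜 j) : partBracket j i Y X = -(sgn i j • partBracket i j X Y) := by
  ext a
  have h1 := partBracket_apply hX hY a
  have h2 := partBracket_apply hY hX a
  have e : ((-(sgn i j • partBracket i j X Y) : der 𝒜)).1 a
      = -(sgn i j • (partBracket i j X Y).1 a) := rfl
  rw [e, h1, h2, smul_sub, smul_smul, sgn_mul_self, sgn_comm j i]
  simp

lemma smul_mem_derDeg' {i l : ZMod 2} {f : A} (hf : f ∈ 𝒜 l) {X : der 𝒜}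
    (hX : X.1 ∈ derDeg 𝒜 i) : (f • X).1 ∈ derDeg 𝒜 (l + i) :=
  smul_mem_derDeg hf hX

lemma partBracket_smul_right {i j l : ZMod 2} {f : A} (hf : f ∈ 𝒜 l) {X Y : der 𝒜}
    (hX : X.1 ∈ derDeg 𝒜 i) (hY : Y.1 ∈ derDeg 𝒜 j) :
    partBracket i (l + j) X (f • Y) = X.1 f • Y + sgn i l • f • partBracket i j X Y := by
  ext a
  have e : (X.1 f • Y + sgn i l • f • partBracket i j X Y : der 𝒜).1 a
      = X.1 f * Y.1 a + sgn i l • (f * (partBracket i j X Y).1 a) := rfl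
  have e' : ∀ a, (f • Y : der 𝒜).1 a = f * Y.1 a := fun _ => rfl
  rw [e, partBracket_apply hX (smul_mem_derDeg' hf hY), partBracket_apply hX hY, e', e',
    hX.2 l f hf, sgn_add_right, mul_sub, smul_sub, mul_smul_comm, smul_smul]
  abel

lemma partBracket_smul_left {i j l : ZMod 2} {f : A} (hf : f ∈ 𝒜 l) {X Y : der 𝒜}
    (hX : X.1 ∈ derDeg 𝒜 i) (hY : Y.1 ∈ derDeg 𝒜 j) :
    partBracket (l + i) j (f • X) Y =
      f • partBracket i j X Y - sgn (l + i) j • Y.1 f • X := by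
  ext a
  have e : (f • partBracket i j X Y - sgn (l + i) j • Y.1 f • X : der 𝒜).1 a
      = f * (partBracket i j X Y).1 a - sgn (l + i) j • (Y.1 f * X.1 a) := rfl
  have e' : ∀ a, (f • X : der 𝒜).1 a = f * X.1 a := fun _ => rfl
  rw [e, partBracket_apply (smul_mem_derDeg' hf hX) hY, partBracket_apply hX hY, e', e',
    hY.2 l f hf, sgn_add_left, mul_sub, smul_add, mul_smul_comm, smul_smul,
    show sgn l j * sgn i j * sgn j l = sgn i j by
      rw [mul_right_comm, sgn_comm j l, sgn_mul_self, one_mul]]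
  abel

namespace IsSuperMetric

variable {d : ZMod 2} {g : der 𝒜 →+ der 𝒜 →+ A}

/-- Graded symmetry moves the second argument to the front and back. The sign involves `f` and `X`
only, not `d`, because the symmetry rule carries no sign from the degree of the metric. -/
lemma smul_right (hg : IsSuperMetric 𝒜 d g) {i l : ZMod 2} {f : A} (hf : f ∈ 𝒜 l) {X : der 𝒜}
    (hX : X.1 ∈ derDeg 𝒜 i) (Y : der 𝒜) : g X (f • Y) = sgn i l • (f * g X Y) := by
  have key : ∀ j (Y : der 𝒜), Y.1 ∈ derDeg 𝒜 j → g X (f • Y) = sgn i l • (f * g X Y) := by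
    intro j Y hY
    rw [hg.symm _ _ _ _ hX (smul_mem_derDeg' hf hY), hg.smul, hg.symm _ _ _ _ hX hY,
      sgn_add_right, mul_smul_comm, smul_smul]
  rw [← homPart_add Y, smul_add, map_add, map_add, key _ _ (homPart_mem 0 Y),
    key _ _ (homPart_mem 1 Y), mul_add, smul_add]

/-- The uniqueness half of non-degeneracy, applied to the linear form `⟨-, W⟩`. Homogeneous test
elements suffice by additivity. -/
lemma ext_right (hg : IsSuperMetric 𝒜 d g) {W W' : der 𝒜}
    (h : ∀ i Z, Z.1 ∈ derDeg 𝒜 i → g Z W = g Z W') : W = W' := by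
  have h' : ∀ Z, g Z W = g Z W' := by
    intro Z
    rw [← homPart_add Z, map_add, AddMonoidHom.add_apply, AddMonoidHom.add_apply,
      h _ _ (homPart_mem 0 Z), h _ _ (homPart_mem 1 Z)]
  let α : der 𝒜 →ₗ[A] A :=
    { toFun := fun Z => g Z W
      map_add' := fun Z Z' => by simp
      map_smul' := fun f Z => hg.smul f Z W }
  exact (hg.nondegenerate α).unique (fun _ => rfl) (fun Z => (h' Z).symm)

lemma ext_left (hg : IsSuperMetric 𝒜 d g) {i : ZMod 2} {W W' : der 𝒜}
    (hW : W.1 ∈ derDeg 𝒜 i) (hW' : W'.1 ∈ derDeg 𝒜 i)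
    (h : ∀ k Z, Z.1 ∈ derDeg 𝒜 k → g W Z = g W' Z) : W = W' :=
  hg.ext_right fun k Z hZ => by
    rw [hg.symm _ _ _ _ hZ hW, hg.symm _ _ _ _ hZ hW', h k Z hZ]

end IsSuperMetric

/-! ### The Koszul formula -/

/-- The right hand side of the Koszul formula for `2⟨∇_X Y, Z⟩`. -/
def koszul (g : der 𝒜 →+ der 𝒜 →+ A) (i j k : ZMod 2) (X Y Z : der 𝒜) : A :=
  X.1 (g Y Z) + sgn i (j + k) • Y.1 (g Z X) - sgn k (i + j) • Z.1 (g X Y)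
    + g (partBracket i j X Y) Z - sgn i (j + k) • g (partBracket j k Y Z) X
    + sgn k (i + j) • g (partBracket k i Z X) Y

section Koszul

variable (g : der 𝒜 →+ der 𝒜 →+ A)

lemma koszul_add₁ (i j k : ZMod 2) (X X' Y Z : der 𝒜) :
    koszul g i j k (X + X') Y Z = koszul g i j k X Y Z + koszul g i j k X' Y Z := by
  simp only [koszul, partBracket_add_left, partBracket_add_right, map_add, Submodule.coe_add,
    LinearMap.add_apply, AddMonoidHom.add_apply, smul_add]
  abel

lemma koszul_add₂ (i j k : ZMod 2) (X Y Y' Z : der 𝒜) :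
    koszul g i j k X (Y + Y') Z = koszul g i j k X Y Z + koszul g i j k X Y' Z := by
  simp only [koszul, partBracket_add_left, partBracket_add_right, map_add, Submodule.coe_add,
    LinearMap.add_apply, AddMonoidHom.add_apply, smul_add]
  abel

lemma koszul_add₃ (i j k : ZMod 2) (X Y Z Z' : der 𝒜) :
    koszul g i j k X Y (Z + Z') = koszul g i j k X Y Z + koszul g i j k X Y Z' := by
  simp only [koszul, partBracket_add_left, partBracket_add_right, map_add, Submodule.coe_add,
    LinearMap.add_apply, AddMonoidHom.add_apply, smul_add]
  abel

lemma koszul_zero₁ (i j k : ZMod 2) (Y Z : der 𝒜) : koszul g i j k 0 Y Z = 0 := by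
  simpa using koszul_add₁ g i j k 0 0 Y Z

lemma koszul_zero₂ (i j k : ZMod 2) (X Z : der 𝒜) : koszul g i j k X 0 Z = 0 := by
  simpa using koszul_add₂ g i j k X 0 0 Z

lemma koszul_zero₃ (i j k : ZMod 2) (X Y : der 𝒜) : koszul g i j k X Y 0 = 0 := by
  simpa using koszul_add₃ g i j k X Y 0 0

/-- The Koszul expression for `2⟨Z, ∇_X Y⟩`, for arbitrary superderivations. -/
def koszulTotal (X Y Z : der 𝒜) : A :=
  ∑ i, ∑ j, ∑ k, sgn k (i + j) • koszul g i j k (homPart i X) (homPart j Y) (homPart k Z)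

lemma koszulTotal_of_mem {i j k : ZMod 2} {X Y Z : der 𝒜} (hX : X.1 ∈ derDeg 𝒜 i)
    (hY : Y.1 ∈ derDeg 𝒜 j) (hZ : Z.1 ∈ derDeg 𝒜 k) :
    koszulTotal g X Y Z = sgn k (i + j) • koszul g i j k X Y Z := by
  unfold koszulTotal
  rw [Finset.sum_eq_single i, Finset.sum_eq_single j, Finset.sum_eq_single k]
  · simp [homPart_of_mem hX, homPart_of_mem hY, homPart_of_mem hZ]
  · intro b _ hb; simp [homPart_of_mem hZ, hb, koszul_zero₃]
  · simp
  · intro b _ hb; simp [homPart_of_mem hY, hb, koszul_zero₂]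
  · simp
  · intro b _ hb; simp [homPart_of_mem hX, hb, koszul_zero₁]
  · simp

lemma koszulTotal_add₁ (X X' Y Z : der 𝒜) :
    koszulTotal g (X + X') Y Z = koszulTotal g X Y Z + koszulTotal g X' Y Z := by
  simp only [koszulTotal, map_add, koszul_add₁, smul_add, Finset.sum_add_distrib]

lemma koszulTotal_add₂ (X Y Y' Z : der 𝒜) :
    koszulTotal g X (Y + Y') Z = koszulTotal g X Y Z + koszulTotal g X Y' Z := by
  simp only [koszulTotal, map_add, koszul_add₂, smul_add, Finset.sum_add_distrib]

lemma koszulTotal_add₃ (X Y Z Z' : der 𝒜) :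
    koszulTotal g X Y (Z + Z') = koszulTotal g X Y Z + koszulTotal g X Y Z' := by
  simp only [koszulTotal, map_add, koszul_add₃, smul_add, Finset.sum_add_distrib]

variable {g}

lemma der_map_mul {i l : ZMod 2} {X : der 𝒜} (hX : X.1 ∈ derDeg 𝒜 i) {f : A} (hf : f ∈ 𝒜 l)
    (b : A) : X.1 (f * b) = X.1 f * b + sgn i l • (f * X.1 b) := hX.2 l f hf b

lemma coe_smul_apply (f : A) (X : der 𝒜) (a : A) : (f • X).1 a = f * X.1 a := rfl

lemma zsmul_form (c : ℤ) (X Y : der 𝒜) : g (c • X) Y = c • g X Y :=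
  DFunLike.congr_fun (map_zsmul g c X) Y

lemma form_sub_left (X X' Y : der 𝒜) : g (X - X') Y = g X Y - g X' Y :=
  DFunLike.congr_fun (map_sub g X X') Y

lemma form_neg_left (X Y : der 𝒜) : g (-X) Y = - g X Y :=
  DFunLike.congr_fun (map_neg g X) Y

-- The terms with `X(f)` and `Y(f)` coming from differentiating the metric cancel against those from
-- the brackets `[fZ, X]` and `[Y, fZ]`. The signs are settled by running through the sixteen parity
-- patterns.
set_option maxHeartbeats 1000000 in
lemma koszul_smul₃ {d : ZMod 2} (hg : IsSuperMetric 𝒜 d g) {i j k l : ZMod 2} {f : A}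
    (hf : f ∈ 𝒜 l) {X Y Z : der 𝒜} (hX : X.1 ∈ derDeg 𝒜 i)
    (hY : Y.1 ∈ derDeg 𝒜 j) (hZ : Z.1 ∈ derDeg 𝒜 k) :
    koszul g i j (l + k) X Y (f • Z) = sgn l (i + j) • (f * koszul g i j k X Y Z) := by
  unfold koszul
  rw [hg.smul_right hf hY, hg.smul, hg.smul_right hf (partBracket_mem i j X Y),
    partBracket_smul_right hf hY hZ, partBracket_smul_left hf hZ hX, map_zsmul,
    der_map_mul hX hf, der_map_mul hY hf, coe_smul_apply, map_add, AddMonoidHom.add_apply,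
    form_sub_left, zsmul_form, zsmul_form, hg.smul, hg.smul, hg.smul, hg.smul,
    hg.symm _ _ _ _ hZ hY]
  simp only [mul_add, mul_sub, mul_smul_comm]
  rcases parity_cases i with rfl | rfl <;> rcases parity_cases j with rfl | rfl <;>
  rcases parity_cases k with rfl | rfl <;> rcases parity_cases l with rfl | rfl <;>
  simp only [sgn_zero_left, sgn_zero_right, sgn_one_one, parity_one_add_one, zero_add, add_zero,
    one_smul, neg_smul, smul_neg, smul_add, smul_sub] <;> abel

-- As in the third slot, every derivative of `f` cancels between a metric term and a bracket term;
-- `f` already stands leftmost, so no sign arises.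
set_option maxHeartbeats 1000000 in
lemma koszul_smul₁ {d : ZMod 2} (hg : IsSuperMetric 𝒜 d g) {i j k l : ZMod 2} {f : A}
    (hf : f ∈ 𝒜 l) {X Y Z : der 𝒜} (hX : X.1 ∈ derDeg 𝒜 i)
    (hY : Y.1 ∈ derDeg 𝒜 j) (hZ : Z.1 ∈ derDeg 𝒜 k) :
    koszul g (l + i) j k (f • X) Y Z = f * koszul g i j k X Y Z := by
  unfold koszul
  rw [hg.smul_right hf hZ, hg.smul, hg.smul_right hf (partBracket_mem j k Y Z),
    partBracket_smul_right hf hZ hX, partBracket_smul_left hf hX hY, map_zsmul,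
    der_map_mul hY hf, der_map_mul hZ hf, coe_smul_apply, map_add, AddMonoidHom.add_apply,
    form_sub_left, zsmul_form, zsmul_form, hg.smul, hg.smul, hg.smul, hg.smul,
    hg.symm _ _ _ _ hX hZ]
  simp only [mul_add, mul_sub, mul_smul_comm]
  rcases parity_cases i with rfl | rfl <;> rcases parity_cases j with rfl | rfl <;>
  rcases parity_cases k with rfl | rfl <;> rcases parity_cases l with rfl | rfl <;>
  simp only [sgn_zero_left, sgn_zero_right, sgn_one_one, parity_one_add_one, zero_add, add_zero,
    one_smul, neg_smul, smul_neg, smul_add] <;> abel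

-- Here the `Z(f)` terms cancel, but the `X(f)` terms from `X⟨fY, Z⟩` and from `[X, fY]` add up.
-- Their sum is the factor 2 that becomes the Leibniz term of the connection.
set_option maxHeartbeats 1000000 in
lemma koszul_smul₂ {d : ZMod 2} (hg : IsSuperMetric 𝒜 d g) {i j k l : ZMod 2} {f : A}
    (hf : f ∈ 𝒜 l) {X Y Z : der 𝒜} (hX : X.1 ∈ derDeg 𝒜 i)
    (hY : Y.1 ∈ derDeg 𝒜 j) (hZ : Z.1 ∈ derDeg 𝒜 k) :
    koszul g i (l + j) k X (f • Y) Z =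
      (2 : ℤ) • (X.1 f * g Y Z) + sgn i l • (f * koszul g i j k X Y Z) := by
  unfold koszul
  rw [hg.smul_right hf hX, hg.smul, hg.smul_right hf (partBracket_mem k i Z X),
    partBracket_smul_right hf hX hY, partBracket_smul_left hf hY hZ, map_zsmul,
    der_map_mul hX hf, der_map_mul hZ hf, coe_smul_apply, map_add, AddMonoidHom.add_apply,
    form_sub_left, zsmul_form, zsmul_form, hg.smul, hg.smul, hg.smul, hg.smul,
    hg.symm _ _ _ _ hY hX]
  simp only [mul_add, mul_sub, mul_smul_comm]
  rcases parity_cases i with rfl | rfl <;> rcases parity_cases j with rfl | rfl <;>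
  rcases parity_cases k with rfl | rfl <;> rcases parity_cases l with rfl | rfl <;>
  simp only [sgn_zero_left, sgn_zero_right, sgn_one_one, parity_one_add_one, zero_add, add_zero,
    one_smul, neg_smul, smul_neg, smul_add, smul_sub] <;> abel

/-- Every term except the one with `[X, Y]` is graded symmetric in `X` and `Y`, or is exchanged with
another such term; the bracket term is skew and doubles. -/
lemma koszul_torsion {d : ZMod 2} (hg : IsSuperMetric 𝒜 d g) {i j k : ZMod 2}
    {X Y Z : der 𝒜} (hX : X.1 ∈ derDeg 𝒜 i)
    (hY : Y.1 ∈ derDeg 𝒜 j) (hZ : Z.1 ∈ derDeg 𝒜 k) :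
    koszul g i j k X Y Z - sgn i j • koszul g j i k Y X Z =
      (2 : ℤ) • g (partBracket i j X Y) Z := by
  unfold koszul
  rw [partBracket_swap hX hY, partBracket_swap hX hZ, partBracket_swap hZ hY,
    hg.symm _ _ _ _ hX hZ, hg.symm _ _ _ _ hZ hY, hg.symm _ _ _ _ hX hY]
  simp only [map_zsmul, form_neg_left, zsmul_form]
  rcases parity_cases i with rfl | rfl <;> rcases parity_cases j with rfl | rfl <;>
  rcases parity_cases k with rfl | rfl <;>
  simp only [sgn_zero_left, sgn_zero_right, sgn_one_one, parity_one_add_one, zero_add, add_zero,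
    one_smul, neg_smul, smul_neg, smul_add, smul_sub] <;> abel

/-- Exchanging `Y` and `Z` cancels everything except `X⟨Y, Z⟩`, which doubles. -/
lemma koszul_metric {d : ZMod 2} (hg : IsSuperMetric 𝒜 d g) {i j k : ZMod 2}
    {X Y Z : der 𝒜} (hX : X.1 ∈ derDeg 𝒜 i)
    (hY : Y.1 ∈ derDeg 𝒜 j) (hZ : Z.1 ∈ derDeg 𝒜 k) :
    koszul g i j k X Y Z + sgn j k • koszul g i k j X Z Y = (2 : ℤ) • X.1 (g Y Z) := by
  unfold koszul
  rw [partBracket_swap hX hY, partBracket_swap hX hZ, partBracket_swap hZ hY,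
    hg.symm _ _ _ _ hX hZ, hg.symm _ _ _ _ hZ hY, hg.symm _ _ _ _ hX hY]
  simp only [map_zsmul, form_neg_left, zsmul_form]
  rcases parity_cases i with rfl | rfl <;> rcases parity_cases j with rfl | rfl <;>
  rcases parity_cases k with rfl | rfl <;>
  simp only [sgn_zero_left, sgn_zero_right, sgn_one_one, parity_one_add_one, zero_add, add_zero,
    one_smul, neg_smul, smul_neg, smul_add, smul_sub] <;> abel

end Koszul
end Metric

/-! ### Existence of the Levi-Civita connection -/

section LeviCivita

variable {A : Type u} [Ring A] [Algebra ℝ A] {𝒜 : ZMod 2 → Submodule ℝ A} [SuperCommAlg 𝒜]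

lemma exists_homogeneous_add (X : der 𝒜) :
    ∃ X₀ X₁ : der 𝒜, X₀.1 ∈ derDeg 𝒜 0 ∧ X₁.1 ∈ derDeg 𝒜 1 ∧ X = X₀ + X₁ :=
  ⟨_, _, homPart_mem 0 X, homPart_mem 1 X, (homPart_add X).symm⟩

lemma two_zsmul_cancel {a b : A} (h : (2 : ℤ) • a = (2 : ℤ) • b) : a = b := by
  have h2 : (2 : ℝ) • a = (2 : ℝ) • b := by
    simpa only [two_smul] using h
  exact smul_right_injective A (two_ne_zero (α := ℝ)) h2

variable {d : ZMod 2} {g : der 𝒜 →+ der 𝒜 →+ A}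

lemma koszul_mem (hg : IsSuperMetric 𝒜 d g) {i j k : ZMod 2}
    {X Y Z : der 𝒜} (hX : X.1 ∈ derDeg 𝒜 i)
    (hY : Y.1 ∈ derDeg 𝒜 j) (hZ : Z.1 ∈ derDeg 𝒜 k) :
    koszul g i j k X Y Z ∈ 𝒜 (i + j + k + d) := by
  have h1 := hX.1 _ _ (hg.deg _ _ _ _ hY hZ)
  have h2 := hY.1 _ _ (hg.deg _ _ _ _ hZ hX)
  have h3 := hZ.1 _ _ (hg.deg _ _ _ _ hX hY)
  have h4 := hg.deg _ _ _ _ (partBracket_mem i j X Y) hZ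
  have h5 := hg.deg _ _ _ _ (partBracket_mem j k Y Z) hX
  have h6 := hg.deg _ _ _ _ (partBracket_mem k i Z X) hY
  rw [show i + (j + k + d) = i + j + k + d by ring] at h1
  rw [show j + (k + i + d) = i + j + k + d by ring] at h2
  rw [show k + (i + j + d) = i + j + k + d by ring] at h3
  rw [show j + k + i + d = i + j + k + d by ring] at h5
  rw [show k + i + j + d = i + j + k + d by ring] at h6
  exact add_mem (sub_mem (add_mem (sub_mem (add_mem h1 (zsmul_mem h2 _)) (zsmul_mem h3 _)) h4)
    (zsmul_mem h5 _)) (zsmul_mem h6 _)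

/-- The sign `sgn k (i + j)` in `koszulTotal` moves `Z` to the left slot. It cancels the sign in
`koszul_smul₃`, leaving honest left linearity, as needed to feed the expression to non-degeneracy.
-/
lemma koszulTotal_smul₃ (hg : IsSuperMetric 𝒜 d g) (f : A) (X Y Z : der 𝒜) :
    koszulTotal g X Y (f • Z) = f * koszulTotal g X Y Z := by
  have key : ∀ (i j k l : ZMod 2) (f : A) (X Y Z : der 𝒜), f ∈ 𝒜 l → X.1 ∈ derDeg 𝒜 i →
      Y.1 ∈ derDeg 𝒜 j → Z.1 ∈ derDeg 𝒜 k →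
      koszulTotal g X Y (f • Z) = f * koszulTotal g X Y Z := by
    intro i j k l f X Y Z hf hX hY hZ
    rw [koszulTotal_of_mem g hX hY hZ, koszulTotal_of_mem g hX hY (smul_mem_derDeg' hf hZ),
      koszul_smul₃ hg hf hX hY hZ, smul_smul, mul_smul_comm, sgn_add_left, mul_right_comm,
      sgn_mul_self, one_mul]
  obtain ⟨f₀, hf₀, f₁, hf₁, rfl⟩ := exists_add_of_internal (𝒜 := 𝒜) f
  obtain ⟨X₀, X₁, hX₀, hX₁, rfl⟩ := exists_homogeneous_add X
  obtain ⟨Y₀, Y₁, hY₀, hY₁, rfl⟩ := exists_homogeneous_add Y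
  obtain ⟨Z₀, Z₁, hZ₀, hZ₁, rfl⟩ := exists_homogeneous_add Z
  simp only [smul_add, add_smul, koszulTotal_add₁, koszulTotal_add₂, koszulTotal_add₃, mul_add,
    add_mul, key _ _ _ _ _ _ _ _ hf₀ hX₀ hY₀ hZ₀, key _ _ _ _ _ _ _ _ hf₀ hX₀ hY₀ hZ₁,
    key _ _ _ _ _ _ _ _ hf₀ hX₀ hY₁ hZ₀, key _ _ _ _ _ _ _ _ hf₀ hX₀ hY₁ hZ₁,
    key _ _ _ _ _ _ _ _ hf₀ hX₁ hY₀ hZ₀, key _ _ _ _ _ _ _ _ hf₀ hX₁ hY₀ hZ₁,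
    key _ _ _ _ _ _ _ _ hf₀ hX₁ hY₁ hZ₀, key _ _ _ _ _ _ _ _ hf₀ hX₁ hY₁ hZ₁,
    key _ _ _ _ _ _ _ _ hf₁ hX₀ hY₀ hZ₀, key _ _ _ _ _ _ _ _ hf₁ hX₀ hY₀ hZ₁,
    key _ _ _ _ _ _ _ _ hf₁ hX₀ hY₁ hZ₀, key _ _ _ _ _ _ _ _ hf₁ hX₀ hY₁ hZ₁,
    key _ _ _ _ _ _ _ _ hf₁ hX₁ hY₀ hZ₀, key _ _ _ _ _ _ _ _ hf₁ hX₁ hY₀ hZ₁,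
    key _ _ _ _ _ _ _ _ hf₁ hX₁ hY₁ hZ₀, key _ _ _ _ _ _ _ _ hf₁ hX₁ hY₁ hZ₁]
  abel

/-- The Koszul expression for `2⟨-, ∇_X Y⟩` as a linear form. -/
def koszulForm (hg : IsSuperMetric 𝒜 d g) (X Y : der 𝒜) : der 𝒜 →ₗ[A] A where
  toFun Z := (2⁻¹ : ℝ) • koszulTotal g X Y Z
  map_add' Z Z' := by rw [koszulTotal_add₃, smul_add]
  map_smul' f Z := by
    rw [koszulTotal_smul₃ hg, RingHom.id_apply, smul_eq_mul, mul_smul_comm]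

lemma exists_koszul_connection (hg : IsSuperMetric 𝒜 d g) :
    ∃ N : der 𝒜 →+ der 𝒜 →+ der 𝒜, ∀ X Y Z, g Z (N X Y) = (2⁻¹ : ℝ) • koszulTotal g X Y Z := by
  choose F hF using fun X Y => (hg.nondegenerate (koszulForm hg X Y)).exists
  have hF' : ∀ X Y Z, g Z (F X Y) = (2⁻¹ : ℝ) • koszulTotal g X Y Z := hF
  have add_right : ∀ X Y Y', F X (Y + Y') = F X Y + F X Y' := fun X Y Y' =>
    hg.ext_right fun _ Z _ => by
      rw [map_add, hF', hF', hF', koszulTotal_add₂, smul_add]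
  have add_left : ∀ X X' Y, F (X + X') Y = F X Y + F X' Y := fun X X' Y =>
    hg.ext_right fun _ Z _ => by
      rw [map_add, hF', hF', hF', koszulTotal_add₁, smul_add]
  exact ⟨AddMonoidHom.mk' (fun X => AddMonoidHom.mk' (F X) (add_right X))
    fun X X' => AddMonoidHom.ext fun Y => add_left X X' Y, hF'⟩

/-- Non-degeneracy returns a vector field with no information on its degree. Its component of the
wrong parity pairs with each homogeneous `Z` to the wrong degree, while the Koszul expression has
only the right one; so that component pairs to zero with everything. -/
lemma koszul_connection_mem (hg : IsSuperMetric 𝒜 d g) {N : der 𝒜 →+ der 𝒜 →+ der 𝒜}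
    (hN : ∀ X Y Z, g Z (N X Y) = (2⁻¹ : ℝ) • koszulTotal g X Y Z) {i j : ZMod 2}
    {X Y : der 𝒜} (hX : X.1 ∈ derDeg 𝒜 i) (hY : Y.1 ∈ derDeg 𝒜 j) :
    (N X Y).1 ∈ derDeg 𝒜 (i + j) := by
  have hsum : homPart (i + j) (N X Y) + homPart (i + j + 1) (N X Y) = N X Y := by
    rcases parity_cases (i + j) with h | h <;> rw [h]
    · exact homPart_add _
    · rw [parity_one_add_one, add_comm]; exact homPart_add _
  have hzero : homPart (i + j + 1) (N X Y) = 0 := by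
    refine hg.ext_right fun k Z hZ => ?_
    have h1 := hg.deg _ _ _ _ hZ (homPart_mem (i + j) (N X Y))
    have h2 := hg.deg _ _ _ _ hZ (homPart_mem (i + j + 1) (N X Y))
    have h3 : g Z (N X Y) ∈ 𝒜 (k + (i + j) + d) := by
      rw [hN, koszulTotal_of_mem g hX hY hZ, show k + (i + j) + d = i + j + k + d by ring]
      exact Submodule.smul_mem _ _ (zsmul_mem (koszul_mem hg hX hY hZ) _)
    rw [map_zero]
    refine eq_zero_of_mem_of_mem (𝒜 := 𝒜) ?_ h2 (j := k + (i + j) + d) ?_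
    · intro h
      have : (1 : ZMod 2) = 0 := by linear_combination h
      exact absurd this (by decide)
    · rw [← hsum, map_add] at h3
      exact (Submodule.add_mem_iff_right _ h1).1 h3
  rw [hzero, add_zero] at hsum
  rw [← hsum]
  exact homPart_mem _ _

lemma two_zsmul_form_koszul_connection (hg : IsSuperMetric 𝒜 d g)
    {N : der 𝒜 →+ der 𝒜 →+ der 𝒜}
    (hN : ∀ X Y Z, g Z (N X Y) = (2⁻¹ : ℝ) • koszulTotal g X Y Z) {i j k : ZMod 2}
    {X Y Z : der 𝒜} (hX : X.1 ∈ derDeg 𝒜 i) (hY : Y.1 ∈ derDeg 𝒜 j)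
    (hZ : Z.1 ∈ derDeg 𝒜 k) : (2 : ℤ) • g (N X Y) Z = koszul g i j k X Y Z := by
  rw [hg.symm _ _ _ _ (koszul_connection_mem hg hN hX hY) hZ, hN, koszulTotal_of_mem g hX hY hZ,
    smul_comm (sgn (i + j) k), smul_smul, sgn_comm k, sgn_mul_self, one_smul, two_smul, ← add_smul]
  norm_num

/-- A torsion-free connection that is compatible with the metric exists. -/
theorem exists_leviCivita (hg : IsSuperMetric 𝒜 d g) :
    ∃ N : der 𝒜 →+ der 𝒜 →+ der 𝒜,
      (∀ (i j : ZMod 2) (X Y : der 𝒜), X.1 ∈ derDeg 𝒜 i → Y.1 ∈ derDeg 𝒜 j →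
        (N X Y).1 ∈ derDeg 𝒜 (i + j)) ∧
      (∀ (f : A) (X Y : der 𝒜), N (f • X) Y = f • N X Y) ∧
      (∀ (i j : ZMod 2) (f : A) (X Y : der 𝒜), X.1 ∈ derDeg 𝒜 i → f ∈ 𝒜 j →
        N X (f • Y) = X.1 f • Y + sgn i j • f • N X Y) ∧
      (∀ (i j : ZMod 2) (X Y : der 𝒜), X.1 ∈ derDeg 𝒜 i → Y.1 ∈ derDeg 𝒜 j →
        N X Y - sgn i j • N Y X - partBracket i j X Y = 0) ∧
      (∀ (i j : ZMod 2) (X Y Z : der 𝒜), X.1 ∈ derDeg 𝒜 i → Y.1 ∈ derDeg 𝒜 j →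
        X.1 (g Y Z) = g (N X Y) Z + sgn i j • g Y (N X Z)) := by
  obtain ⟨N, hN⟩ := exists_koszul_connection hg
  have hdeg : ∀ (i j : ZMod 2) (X Y : der 𝒜), X.1 ∈ derDeg 𝒜 i → Y.1 ∈ derDeg 𝒜 j →
        (N X Y).1 ∈ derDeg 𝒜 (i + j) := fun i j X Y hX hY => koszul_connection_mem hg hN hX hY
  refine ⟨N, hdeg, ?_, ?_, ?_, ?_⟩
  · have key : ∀ (i j l : ZMod 2) (f : A) (X Y : der 𝒜), f ∈ 𝒜 l → X.1 ∈ derDeg 𝒜 i →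
        Y.1 ∈ derDeg 𝒜 j → N (f • X) Y = f • N X Y := by
      intro i j l f X Y hf hX hY
      refine hg.ext_left (hdeg _ _ _ _ (smul_mem_derDeg' hf hX) hY)
        (add_assoc l i j ▸ smul_mem_derDeg' hf (hdeg _ _ _ _ hX hY)) fun k Z hZ => ?_
      apply two_zsmul_cancel
      rw [two_zsmul_form_koszul_connection hg hN (smul_mem_derDeg' hf hX) hY hZ, hg.smul,
        ← mul_smul_comm, two_zsmul_form_koszul_connection hg hN hX hY hZ,
        koszul_smul₁ hg hf hX hY hZ]
    intro f X Y
    obtain ⟨f₀, hf₀, f₁, hf₁, rfl⟩ := exists_add_of_internal (𝒜 := 𝒜) f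
    obtain ⟨X₀, X₁, hX₀, hX₁, rfl⟩ := exists_homogeneous_add X
    obtain ⟨Y₀, Y₁, hY₀, hY₁, rfl⟩ := exists_homogeneous_add Y
    simp only [smul_add, add_smul, map_add, AddMonoidHom.add_apply,
      key _ _ _ _ _ _ hf₀ hX₀ hY₀, key _ _ _ _ _ _ hf₀ hX₀ hY₁,
      key _ _ _ _ _ _ hf₀ hX₁ hY₀, key _ _ _ _ _ _ hf₀ hX₁ hY₁,
      key _ _ _ _ _ _ hf₁ hX₀ hY₀, key _ _ _ _ _ _ hf₁ hX₀ hY₁,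
      key _ _ _ _ _ _ hf₁ hX₁ hY₀, key _ _ _ _ _ _ hf₁ hX₁ hY₁]
  · have key : ∀ (i j l : ZMod 2) (f : A) (X Y : der 𝒜), f ∈ 𝒜 l → X.1 ∈ derDeg 𝒜 i →
        Y.1 ∈ derDeg 𝒜 j → N X (f • Y) = X.1 f • Y + sgn i l • f • N X Y := by
      intro i j l f X Y hf hX hY
      have hdeg' : (X.1 f • Y + sgn i l • f • N X Y).1 ∈ derDeg 𝒜 (i + (l + j)) := by
        refine add_mem ?_ (zsmul_mem ?_ _)
        · exact add_assoc i l j ▸ smul_mem_derDeg' (hX.1 _ _ hf) hY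
        · exact add_left_comm l i j ▸ smul_mem_derDeg' hf (hdeg _ _ _ _ hX hY)
      refine hg.ext_left (hdeg _ _ _ _ hX (smul_mem_derDeg' hf hY)) hdeg' fun k Z hZ => ?_
      apply two_zsmul_cancel
      rw [two_zsmul_form_koszul_connection hg hN hX (smul_mem_derDeg' hf hY) hZ,
        map_add, AddMonoidHom.add_apply, zsmul_form, hg.smul, hg.smul, smul_add,
        smul_comm (2 : ℤ) (sgn i l),
        ← mul_smul_comm (2 : ℤ) f, two_zsmul_form_koszul_connection hg hN hX hY hZ,
        koszul_smul₂ hg hf hX hY hZ]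
    intro i l f X Y hX hf
    obtain ⟨Y₀, Y₁, hY₀, hY₁, rfl⟩ := exists_homogeneous_add Y
    simp only [smul_add, map_add, key _ _ _ _ _ _ hf hX hY₀, key _ _ _ _ _ _ hf hX hY₁]
    abel
  · intro i j X Y hX hY
    have hdeg' : (N X Y - sgn i j • N Y X).1 ∈ derDeg 𝒜 (i + j) :=
      sub_mem (hdeg _ _ _ _ hX hY) (zsmul_mem (add_comm j i ▸ hdeg _ _ _ _ hY hX) _)
    refine sub_eq_zero_of_eq (hg.ext_left hdeg' (partBracket_mem i j X Y) fun k Z hZ => ?_)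
    apply two_zsmul_cancel
    rw [form_sub_left, zsmul_form, smul_sub, smul_comm (2 : ℤ) (sgn i j),
      two_zsmul_form_koszul_connection hg hN hX hY hZ,
      two_zsmul_form_koszul_connection hg hN hY hX hZ, koszul_torsion hg hX hY hZ]
  · have key : ∀ (i j k : ZMod 2) (X Y Z : der 𝒜), X.1 ∈ derDeg 𝒜 i → Y.1 ∈ derDeg 𝒜 j →
        Z.1 ∈ derDeg 𝒜 k → X.1 (g Y Z) = g (N X Y) Z + sgn i j • g Y (N X Z) := by
      intro i j k X Y Z hX hY hZ
      apply two_zsmul_cancel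
      rw [hg.symm _ _ _ _ hY (hdeg _ _ _ _ hX hZ), smul_smul, sgn_add_right, sgn_comm j i,
        ← mul_assoc, sgn_mul_self, one_mul, smul_add, smul_comm (2 : ℤ) (sgn j k),
        two_zsmul_form_koszul_connection hg hN hX hY hZ,
        two_zsmul_form_koszul_connection hg hN hX hZ hY, koszul_metric hg hX hY hZ]
    intro i j X Y Z hX hY
    obtain ⟨Z₀, Z₁, hZ₀, hZ₁, rfl⟩ := exists_homogeneous_add Z
    simp only [smul_add, map_add, key _ _ _ _ _ _ hX hY hZ₀, key _ _ _ _ _ _ hX hY hZ₁]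
    abel

/-! ### Uniqueness of the Levi-Civita connection -/

/-- A graded symmetric tensor that is skew with respect to the metric vanishes. -/
lemma symm_skew_eq_zero (hg : IsSuperMetric 𝒜 d g) {S : der 𝒜 →+ der 𝒜 →+ der 𝒜}
    (hdeg : ∀ (i j : ZMod 2) (X Y : der 𝒜), X.1 ∈ derDeg 𝒜 i → Y.1 ∈ derDeg 𝒜 j →
      (S X Y).1 ∈ derDeg 𝒜 (i + j))
    (hsymm : ∀ (i j : ZMod 2) (X Y : der 𝒜), X.1 ∈ derDeg 𝒜 i → Y.1 ∈ derDeg 𝒜 j →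
      S X Y = sgn i j • S Y X)
    (hskew : ∀ (i j : ZMod 2) (X Y Z : der 𝒜), X.1 ∈ derDeg 𝒜 i → Y.1 ∈ derDeg 𝒜 j →
      g (S X Y) Z + sgn i j • g Y (S X Z) = 0) : S = 0 := by
  have swap₁ : ∀ (i j : ZMod 2) (X Y Z : der 𝒜), X.1 ∈ derDeg 𝒜 i → Y.1 ∈ derDeg 𝒜 j →
      g (S X Y) Z = sgn i j • g (S Y X) Z := by
    intro i j X Y Z hX hY
    rw [hsymm _ _ _ _ hX hY, zsmul_form]
  have swap₂ : ∀ (i j k : ZMod 2) (X Y Z : der 𝒜), X.1 ∈ derDeg 𝒜 i → Y.1 ∈ derDeg 𝒜 j →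
      Z.1 ∈ derDeg 𝒜 k → g (S X Y) Z = -(sgn j k • g (S X Z) Y) := by
    intro i j k X Y Z hX hY hZ
    rw [eq_neg_iff_add_eq_zero, ← hskew _ _ _ _ Z hX hY,
      hg.symm _ _ _ _ hY (hdeg _ _ _ _ hX hZ), smul_smul, sgn_add_right, sgn_comm j i,
        ← mul_assoc, sgn_mul_self, one_mul]
  refine addHom_ext_of_homogeneous fun i X hX => addHom_ext_of_homogeneous fun j Y hY => ?_
  refine hg.ext_left (hdeg _ _ _ _ hX hY) (zero_mem _) fun k Z hZ => two_zsmul_cancel ?_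
  -- Alternating the skew and symmetric exchanges runs `XYZ → XZY → ZXY → ZYX → YZX → YXZ → XYZ`.
  -- Each parity sign occurs twice and cancels, while the three skew exchanges leave an overall
  -- minus sign.
  have h : g (S X Y) Z = -g (S X Y) Z := by
    conv_lhs =>
      rw [swap₂ _ _ _ _ _ _ hX hY hZ, swap₁ _ _ _ _ _ hX hZ, swap₂ _ _ _ _ _ _ hZ hX hY,
        swap₁ _ _ _ _ _ hZ hY, swap₂ _ _ _ _ _ _ hY hZ hX, swap₁ _ _ _ _ _ hY hX]
    rcases parity_cases i with rfl | rfl <;> rcases parity_cases j with rfl | rfl <;>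
    rcases parity_cases k with rfl | rfl <;>
    simp only [sgn_zero_left, sgn_zero_right, sgn_one_one, one_smul, neg_smul, neg_neg]
  simp only [AddMonoidHom.zero_apply, map_zero, smul_zero, two_smul]
  exact eq_neg_iff_add_eq_zero.1 h

end LeviCivita

/-! ### Semi-symmetric non-metric connections -/

section SemiSymmetric

variable {A : Type u} [Ring A] [Algebra ℝ A] {𝒜 : ZMod 2 → Submodule ℝ A} [SuperCommAlg 𝒜]

/-- `N` is a connection on the module of superderivations. -/
structure IsConnection (N : der 𝒜 →+ der 𝒜 →+ der 𝒜) : Prop where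
  deg : ∀ (i j : ZMod 2) (X Y : der 𝒜), X.1 ∈ derDeg 𝒜 i → Y.1 ∈ derDeg 𝒜 j →
    (N X Y).1 ∈ derDeg 𝒜 (i + j)
  smul_left : ∀ (f : A) (X Y : der 𝒜), N (f • X) Y = f • N X Y
  leibniz : ∀ (i j : ZMod 2) (f : A) (X Y : der 𝒜), X.1 ∈ derDeg 𝒜 i → f ∈ 𝒜 j →
    N X (f • Y) = X.1 f • Y + sgn i j • f • N X Y

/-- The torsion of `N`, on superderivations of degrees `i` and `j`. -/
def torsionAux (N : der 𝒜 →+ der 𝒜 →+ der 𝒜) (i j : ZMod 2) (X Y : der 𝒜) : der 𝒜 :=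
  N X Y - sgn i j • N Y X - partBracket i j X Y

/-- The torsion of `N` vanishes. -/
def IsTorsionFree (N : der 𝒜 →+ der 𝒜 →+ der 𝒜) : Prop :=
  ∀ (i j : ZMod 2) (X Y : der 𝒜), X.1 ∈ derDeg 𝒜 i → Y.1 ∈ derDeg 𝒜 j →
    torsionAux N i j X Y = 0

/-- `N` is compatible with the form `g`. -/
def IsCompatible (g : der 𝒜 →+ der 𝒜 →+ A) (N : der 𝒜 →+ der 𝒜 →+ der 𝒜) : Prop :=
  ∀ (i j : ZMod 2) (X Y Z : der 𝒜), X.1 ∈ derDeg 𝒜 i → Y.1 ∈ derDeg 𝒜 j →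
    X.1 (g Y Z) = g (N X Y) Z + sgn i j • g Y (N X Z)

/-- `X · g(Y, P)`, for `X` and `Y` of degrees `i` and `j`. -/
def twist (g : der 𝒜 →+ der 𝒜 →+ A) (P : der 𝒜) (i j : ZMod 2) (X Y : der 𝒜) : der 𝒜 :=
  sgn i j • g Y P • X

/-- `N` has the semi-symmetric torsion given by `g` and `P`. -/
def HasSemiTorsion (g : der 𝒜 →+ der 𝒜 →+ A) (P : der 𝒜) (N : der 𝒜 →+ der 𝒜 →+ der 𝒜) :
    Prop :=
  ∀ (i j : ZMod 2) (X Y : der 𝒜), X.1 ∈ derDeg 𝒜 i → Y.1 ∈ derDeg 𝒜 j →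
    torsionAux N i j X Y =
      twist g P i j X Y - sgn i j • twist g P j i Y X

/-- `N` has the non-metricity of a semi-symmetric non-metric connection. -/
def HasSemiNonMetricity (g : der 𝒜 →+ der 𝒜 →+ A) (P : der 𝒜)
    (N : der 𝒜 →+ der 𝒜 →+ der 𝒜) : Prop :=
  ∀ (i j k : ZMod 2) (X Y Z : der 𝒜), X.1 ∈ derDeg 𝒜 i → Y.1 ∈ derDeg 𝒜 j →
    Z.1 ∈ derDeg 𝒜 k →
    g (N X Y) Z + sgn i j • g Y (N X Z) =
      X.1 (g Y Z) + sgn i j • (g Y P * g X Z) +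
        (sgn i j * sgn k (i + j)) • (g Z P * g Y X)

variable {d : ZMod 2} {g : der 𝒜 →+ der 𝒜 →+ A} {P : der 𝒜}

lemma coe_sub_apply (X Y : der 𝒜) (a : A) : (X - Y).1 a = X.1 a - Y.1 a := rfl

lemma coe_add_apply (X Y : der 𝒜) (a : A) : (X + Y).1 a = X.1 a + Y.1 a := rfl

lemma coe_zsmul_apply (c : ℤ) (X : der 𝒜) (a : A) : (c • X).1 a = c • X.1 a := rfl

lemma coe_torsionAux_apply (N : der 𝒜 →+ der 𝒜 →+ der 𝒜) (i j : ZMod 2) (X Y : der 𝒜) (a : A) :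
    (torsionAux N i j X Y).1 a =
      (N X Y).1 a - sgn i j • (N Y X).1 a - (partBracket i j X Y).1 a := rfl

lemma coe_zero_apply (a : A) : (0 : der 𝒜).1 a = 0 := rfl

/-- The difference of the two connections is graded symmetric because both torsions vanish, and skew
because both are compatible. The terms `[X, Y]` and `X⟨Y, Z⟩` drop out of the difference. -/
lemma leviCivita_unique (hg : IsSuperMetric 𝒜 d g) {N N' : der 𝒜 →+ der 𝒜 →+ der 𝒜}
    (hN : IsConnection N) (hN' : IsConnection N') (ht : IsTorsionFree N)
    (ht' : IsTorsionFree N') (hm : IsCompatible g N) (hm' : IsCompatible g N') : N = N' := by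
  have h : N - N' = 0 := by
    refine symm_skew_eq_zero hg ?_ ?_ ?_
    · intro i j X Y hX hY
      exact sub_mem (hN.deg i j X Y hX hY) (hN'.deg i j X Y hX hY)
    · intro i j X Y hX hY
      ext a
      have h1 := LinearMap.congr_fun (congrArg Subtype.val (ht i j X Y hX hY)) a
      have h2 := LinearMap.congr_fun (congrArg Subtype.val (ht' i j X Y hX hY)) a
      rw [coe_torsionAux_apply, coe_zero_apply, sub_eq_zero] at h1 h2
      have e : ∀ X Y, ((N - N') X Y).1 a = (N X Y).1 a - (N' X Y).1 a := fun _ _ => rfl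
      rw [coe_zsmul_apply, e, e, smul_sub, sub_eq_sub_iff_sub_eq_sub, h1, h2]
    · intro i j X Y Z hX hY
      have h1 := hm i j X Y Z hX hY
      rw [hm' i j X Y Z hX hY] at h1
      have e1 : g ((N - N') X Y) Z = g (N X Y) Z - g (N' X Y) Z :=
        form_sub_left (N X Y) (N' X Y) Z
      have e2 : g Y ((N - N') X Z) = g Y (N X Z) - g Y (N' X Z) :=
        map_sub (g Y) (N X Z) (N' X Z)
      rw [e1, e2, smul_sub, sub_add_sub_comm, ← h1, sub_self]
  exact sub_eq_zero.1 h

/-- The degrees of `P` and of the metric cancel modulo 2. This is the one place where `|P| = |g|`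
enters. -/
lemma IsSuperMetric.apply_mem (hg : IsSuperMetric 𝒜 d g) (hP : P.1 ∈ derDeg 𝒜 d) {j : ZMod 2}
    {Y : der 𝒜} (hY : Y.1 ∈ derDeg 𝒜 j) : g Y P ∈ 𝒜 j := by
  have h := hg.deg _ _ _ _ hY hP
  rwa [add_assoc, show d + d = 0 from CharTwo.add_self_eq_zero _, add_zero] at h

lemma twist_mem (hg : IsSuperMetric 𝒜 d g) (hP : P.1 ∈ derDeg 𝒜 d) {i j : ZMod 2} {X Y : der 𝒜}
    (hX : X.1 ∈ derDeg 𝒜 i) (hY : Y.1 ∈ derDeg 𝒜 j) :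
    (twist g P i j X Y).1 ∈ derDeg 𝒜 (i + j) :=
  zsmul_mem (add_comm j i ▸ smul_mem_derDeg' (hg.apply_mem hP hY) hX) _

lemma coe_twist_apply (i j : ZMod 2) (X Y : der 𝒜) (a : A) :
    (twist g P i j X Y).1 a = sgn i j • (g Y P * X.1 a) := rfl

lemma twist_add_left (i j : ZMod 2) (X X' Y : der 𝒜) :
    twist g P i j (X + X') Y = twist g P i j X Y + twist g P i j X' Y := by
  ext a
  simp only [coe_twist_apply, coe_add_apply, mul_add, smul_add]

lemma twist_add_right (i j : ZMod 2) (X Y Y' : der 𝒜) :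
    twist g P i j X (Y + Y') = twist g P i j X Y + twist g P i j X Y' := by
  ext a
  simp only [coe_twist_apply, coe_add_apply, map_add, AddMonoidHom.add_apply, add_mul, smul_add]

variable (g P) in
/-- The tensor `(X, Y) ↦ X · g(Y, P)`. -/
def twistTensor : der 𝒜 →+ der 𝒜 →+ der 𝒜 :=
  AddMonoidHom.mk' (fun X => AddMonoidHom.mk'
    (fun Y => ∑ i, ∑ j, twist g P i j (homPart i X) (homPart j Y))
    (fun Y Y' => by simp only [map_add, twist_add_right, Finset.sum_add_distrib]))
    (fun X X' => AddMonoidHom.ext fun Y => by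
      simp only [map_add, AddMonoidHom.add_apply, AddMonoidHom.mk'_apply, twist_add_left,
        Finset.sum_add_distrib])

lemma twist_zero_left (i j : ZMod 2) (Y : der 𝒜) : twist g P i j 0 Y = 0 := by
  simpa using twist_add_left (g := g) (P := P) i j 0 0 Y

lemma twist_zero_right (i j : ZMod 2) (X : der 𝒜) : twist g P i j X 0 = 0 := by
  simpa using twist_add_right (g := g) (P := P) i j X 0 0

lemma twistTensor_of_mem {i j : ZMod 2} {X Y : der 𝒜} (hX : X.1 ∈ derDeg 𝒜 i)
    (hY : Y.1 ∈ derDeg 𝒜 j) : twistTensor g P X Y = twist g P i j X Y := by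
  change ∑ i, ∑ j, twist g P i j (homPart i X) (homPart j Y) = _
  rw [Finset.sum_eq_single i, Finset.sum_eq_single j]
  · rw [homPart_of_mem hX, homPart_of_mem hY, if_pos rfl, if_pos rfl]
  · intro b _ hb; rw [homPart_of_mem hY, if_neg hb, twist_zero_right]
  · simp
  · intro b _ hb
    rw [homPart_of_mem hX, if_neg hb]
    simp only [twist_zero_left, Finset.sum_const_zero]
  · simp

/-- The sign from moving `f` past `g(Y, P)` cancels the one by which `X · h` changes when `X`
becomes `fX`; here `g(Y, P)` must have the degree of `Y`. -/
lemma twistTensor_smul_left (hg : IsSuperMetric 𝒜 d g) (hP : P.1 ∈ derDeg 𝒜 d) (f : A)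
    (X Y : der 𝒜) : twistTensor g P (f • X) Y = f • twistTensor g P X Y := by
  have key : ∀ (i j l : ZMod 2) (f : A) (X Y : der 𝒜), f ∈ 𝒜 l → X.1 ∈ derDeg 𝒜 i →
      Y.1 ∈ derDeg 𝒜 j → twistTensor g P (f • X) Y = f • twistTensor g P X Y := by
    intro i j l f X Y hf hX hY
    rw [twistTensor_of_mem (smul_mem_derDeg' hf hX) hY, twistTensor_of_mem hX hY]
    ext a
    rw [coe_smul_apply, coe_twist_apply, coe_twist_apply, coe_smul_apply, ← mul_assoc,
      SuperCommAlg.super_comm j l _ (hg.apply_mem hP hY) f hf, smul_mul_assoc,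
      smul_smul, mul_smul_comm, sgn_add_left, sgn_comm j l, mul_right_comm, sgn_mul_self, one_mul,
      mul_assoc]
  obtain ⟨f₀, hf₀, f₁, hf₁, rfl⟩ := exists_add_of_internal (𝒜 := 𝒜) f
  obtain ⟨X₀, X₁, hX₀, hX₁, rfl⟩ := exists_homogeneous_add X
  obtain ⟨Y₀, Y₁, hY₀, hY₁, rfl⟩ := exists_homogeneous_add Y
  simp only [smul_add, add_smul, map_add, AddMonoidHom.add_apply,
    key _ _ _ _ _ _ hf₀ hX₀ hY₀, key _ _ _ _ _ _ hf₀ hX₀ hY₁,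
    key _ _ _ _ _ _ hf₀ hX₁ hY₀, key _ _ _ _ _ _ hf₀ hX₁ hY₁,
    key _ _ _ _ _ _ hf₁ hX₀ hY₀, key _ _ _ _ _ _ hf₁ hX₀ hY₁,
    key _ _ _ _ _ _ hf₁ hX₁ hY₀, key _ _ _ _ _ _ hf₁ hX₁ hY₁]

lemma twistTensor_smul_right (hg : IsSuperMetric 𝒜 d g) {i l : ZMod 2} {f : A}
    {X : der 𝒜} (hX : X.1 ∈ derDeg 𝒜 i) (hf : f ∈ 𝒜 l) (Y : der 𝒜) :
    twistTensor g P X (f • Y) = sgn i l • f • twistTensor g P X Y := by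
  have key : ∀ (j : ZMod 2) (Y : der 𝒜), Y.1 ∈ derDeg 𝒜 j →
      twistTensor g P X (f • Y) = sgn i l • f • twistTensor g P X Y := by
    intro j Y hY
    rw [twistTensor_of_mem hX (smul_mem_derDeg' hf hY), twistTensor_of_mem hX hY]
    ext a
    rw [coe_zsmul_apply, coe_smul_apply, coe_twist_apply, coe_twist_apply, hg.smul,
      mul_smul_comm, smul_smul, sgn_add_right, mul_assoc]
  obtain ⟨Y₀, Y₁, hY₀, hY₁, rfl⟩ := exists_homogeneous_add Y
  simp only [smul_add, map_add, key _ _ hY₀, key _ _ hY₁]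

/-- Connections form an affine space over graded tensors. The cases `c = 1` and `c = -1` are the two
directions of the correspondence with the Levi-Civita connection. -/
lemma IsConnection.add_twistTensor (hg : IsSuperMetric 𝒜 d g) (hP : P.1 ∈ derDeg 𝒜 d)
    {N : der 𝒜 →+ der 𝒜 →+ der 𝒜} (hN : IsConnection N) (c : ℤ) :
    IsConnection (N + c • twistTensor g P) := by
  have e : ∀ X Y a, ((N + c • twistTensor g P) X Y).1 a =
      (N X Y).1 a + c • (twistTensor g P X Y).1 a := fun _ _ _ => rfl
  refine ⟨fun i j X Y hX hY => ?_, fun f X Y => ?_, fun i j f X Y hX hf => ?_⟩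
  · refine add_mem (hN.deg i j X Y hX hY) (zsmul_mem ?_ c)
    rw [twistTensor_of_mem hX hY]
    exact twist_mem hg hP hX hY
  · ext a
    rw [e, coe_smul_apply, e, hN.smul_left, twistTensor_smul_left hg hP, coe_smul_apply,
      coe_smul_apply, mul_add, mul_smul_comm]
  · ext a
    rw [e, coe_add_apply, coe_zsmul_apply, coe_smul_apply, coe_smul_apply, e,
      hN.leibniz i j f X Y hX hf, twistTensor_smul_right hg hX hf, coe_add_apply,
      coe_zsmul_apply, coe_zsmul_apply, coe_smul_apply, coe_smul_apply, coe_smul_apply,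
      mul_add, mul_smul_comm, smul_add, smul_comm c, add_assoc]

variable {N L : der 𝒜 →+ der 𝒜 →+ der 𝒜}

lemma hasSemiTorsion_iff
    (h : ∀ (i j : ZMod 2) (X Y : der 𝒜), X.1 ∈ derDeg 𝒜 i → Y.1 ∈ derDeg 𝒜 j →
      N X Y = L X Y + twist g P i j X Y) :
    HasSemiTorsion g P N ↔ IsTorsionFree L := by
  refine forall_congr' fun i => forall_congr' fun j => forall_congr' fun X => forall_congr' fun Y =>
    forall_congr' fun hX => forall_congr' fun hY => ?_
  constructor <;> intro H <;> ext a <;>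
    have H' := LinearMap.congr_fun (congrArg Subtype.val H) a
  · simp only [coe_torsionAux_apply, coe_sub_apply, coe_add_apply, coe_zsmul_apply, smul_add,
      coe_zero_apply, h i j X Y hX hY, h j i Y X hY hX] at H' ⊢
    rw [← sub_eq_zero] at H'
    rw [← H']
    abel
  · simp only [coe_torsionAux_apply, coe_sub_apply, coe_add_apply, coe_zsmul_apply, smul_add,
      coe_zero_apply, h i j X Y hX hY, h j i Y X hY hX] at H' ⊢
    rw [← sub_eq_zero, ← H']
    abel

lemma form_twist_left (hg : IsSuperMetric 𝒜 d g) (i j : ZMod 2) (X Y Z : der 𝒜) :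
    g (twist g P i j X Y) Z = sgn i j • (g Y P * g X Z) := by
  rw [twist, zsmul_form, hg.smul]

lemma form_twist_right (hg : IsSuperMetric 𝒜 d g) (hP : P.1 ∈ derDeg 𝒜 d) {i j k : ZMod 2}
    {X Y Z : der 𝒜} (hY : Y.1 ∈ derDeg 𝒜 j) (hZ : Z.1 ∈ derDeg 𝒜 k) :
    g Y (twist g P i k X Z) = sgn k (i + j) • (g Z P * g Y X) := by
  rw [twist, show g Y (sgn i k • g Z P • X) = sgn i k • g Y (g Z P • X) from map_zsmul (g Y) _ _,
    hg.smul_right (hg.apply_mem hP hZ) hY, smul_smul, sgn_add_right, sgn_comm i k, sgn_comm j k]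

/-- The two extra terms of the non-metricity are exactly what the twist contributes in the first and
in the second slot of the metric. -/
lemma hasSemiNonMetricity_iff (hg : IsSuperMetric 𝒜 d g) (hP : P.1 ∈ derDeg 𝒜 d)
    (h : ∀ (i j : ZMod 2) (X Y : der 𝒜), X.1 ∈ derDeg 𝒜 i → Y.1 ∈ derDeg 𝒜 j →
      N X Y = L X Y + twist g P i j X Y) :
    HasSemiNonMetricity g P N ↔ IsCompatible g L := by
  have key : ∀ (i j k : ZMod 2) (X Y Z : der 𝒜), X.1 ∈ derDeg 𝒜 i → Y.1 ∈ derDeg 𝒜 j →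
      Z.1 ∈ derDeg 𝒜 k → g (N X Y) Z + sgn i j • g Y (N X Z) =
        g (L X Y) Z + sgn i j • g Y (L X Z) + sgn i j • (g Y P * g X Z) +
          (sgn i j * sgn k (i + j)) • (g Z P * g Y X) := by
    intro i j k X Y Z hX hY hZ
    rw [h i j X Y hX hY, h i k X Z hX hZ, map_add, map_add, AddMonoidHom.add_apply,
      form_twist_left hg, form_twist_right hg hP hY hZ, smul_add, smul_smul]
    abel
  constructor
  · intro hD i j X Y Z hX hY
    -- Non-metricity is prescribed for homogeneous `Z` only, whereas compatibility asks for every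
    -- `Z`; the two are bridged by splitting `Z` into its parts.
    have hom : ∀ (k : ZMod 2) (Z : der 𝒜), Z.1 ∈ derDeg 𝒜 k → X.1 (g Y Z) =
        g (L X Y) Z + sgn i j • g Y (L X Z) := by
      intro k Z hZ
      have h1 := hD i j k X Y Z hX hY hZ
      rw [key i j k X Y Z hX hY hZ] at h1
      exact (add_right_cancel (add_right_cancel h1)).symm
    obtain ⟨Z₀, Z₁, hZ₀, hZ₁, rfl⟩ := exists_homogeneous_add Z
    simp only [smul_add, map_add]
    rw [hom _ _ hZ₀, hom _ _ hZ₁]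
    abel
  · intro hL i j k X Y Z hX hY hZ
    rw [key i j k X Y Z hX hY hZ, hL i j X Y Z hX hY]

/-- If a connection with semi-symmetric non-metricity is compatible with the metric, then
`g(Y, P) Z + (-1)^{|Y||Z|} g(Z, P) Y = 0`. -/
lemma smul_add_smul_eq_zero (hg : IsSuperMetric 𝒜 d g) (hP : P.1 ∈ derDeg 𝒜 d)
    (hN : HasSemiNonMetricity g P N) (hN' : IsCompatible g N) {j k : ZMod 2} {Y Z : der 𝒜}
    (hY : Y.1 ∈ derDeg 𝒜 j) (hZ : Z.1 ∈ derDeg 𝒜 k) :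
    g Y P • Z + sgn j k • g Z P • Y = 0 := by
  refine hg.ext_right fun i X hX => ?_
  have h := hN i j k X Y Z hX hY hZ
  rw [← hN' i j X Y Z hX hY, add_assoc, left_eq_add, hg.symm _ _ _ _ hY hX, mul_smul_comm,
    smul_smul] at h
  rw [map_add, show g X (sgn j k • g Z P • Y) = sgn j k • g X (g Z P • Y) from map_zsmul (g X) _ _,
    hg.smul_right (hg.apply_mem hP hY) hX, hg.smul_right (hg.apply_mem hP hZ) hX, map_zero,
    smul_smul, ← h, sgn_add_right, sgn_comm k i, sgn_comm k j, sgn_comm j i]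
  congr 2
  linear_combination (-(sgn i k * sgn j k)) * sgn_mul_self i j

end SemiSymmetric

/-! ### Transfer to affine connections on a supermanifold -/

section Connections

open SuperRingedSpace

variable {m n : ℕ} {M : SuperManifold.{u} m n}

lemma SuperMetric.isSuperMetric (g : SuperMetric M) :
    IsSuperMetric (M.gr ⊤) g.deg (g.form ⊤) where
  deg := g.form_deg ⊤
  symm := g.form_symm ⊤
  smul := g.form_smul ⊤
  nondegenerate := g.nondegenerate ⊤

lemma bracket_eq_partBracket {i j : ZMod 2} {X Y : M.Vect} (hX : HasDeg i X) (hY : HasDeg j Y) :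
    bracket hX hY = partBracket i j X Y := by
  ext a
  exact (partBracket_apply hX hY a).symm

lemma AffineConnection.isConnection (D : AffineConnection M) : IsConnection D.nabla :=
  ⟨D.nabla_deg, D.smul_left, D.leibniz⟩

lemma AffineConnection.torsion_apply (D : AffineConnection M) {i j : ZMod 2} {X Y : M.Vect}
    (hX : HasDeg i X) (hY : HasDeg j Y) (a : M.Fn) : (D.torsion hX hY).1 a =
      (D.nabla X Y).1 a - sgn i j • (D.nabla Y X).1 a - (bracket hX hY).1 a := rfl

lemma AffineConnection.torsion_eq (D : AffineConnection M) {i j : ZMod 2} {X Y : M.Vect}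
    (hX : HasDeg i X) (hY : HasDeg j Y) : D.torsion hX hY = torsionAux D.nabla i j X Y := by
  ext a
  have h := D.torsion_apply hX hY a
  rw [bracket_eq_partBracket hX hY] at h
  exact h

lemma AffineConnection.isSymmetric_iff (D : AffineConnection M) :
    D.IsSymmetric ↔ IsTorsionFree D.nabla := by
  refine forall_congr' fun i => forall_congr' fun j => forall_congr' fun X => forall_congr' fun Y =>
    forall_congr' fun hX => forall_congr' fun hY => ?_
  rw [AffineConnection.torsion_eq]

lemma AffineConnection.isLeviCivita_iff (D : AffineConnection M) (g : SuperMetric M) :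
    D.IsLeviCivita g ↔ IsTorsionFree D.nabla ∧ IsCompatible (g.form ⊤) D.nabla :=
  and_congr D.isSymmetric_iff Iff.rfl

lemma AffineConnection.hasSemiSymmetricTorsion_iff (D : AffineConnection M) (g : SuperMetric M)
    (P : M.Vect) : D.HasSemiSymmetricTorsion g P ↔ HasSemiTorsion (g.form ⊤) P D.nabla := by
  refine forall_congr' fun i => forall_congr' fun j => forall_congr' fun X => forall_congr' fun Y =>
    forall_congr' fun hX => forall_congr' fun hY => ?_
  rw [AffineConnection.torsion_eq]
  exact Iff.rfl

lemma SuperMetric.exists_leviCivita (g : SuperMetric M) :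
    ∃ L : AffineConnection M, L.IsLeviCivita g := by
  obtain ⟨N, hdeg, hsmul, hleib, htor, hmet⟩ := SuperGeometry.exists_leviCivita g.isSuperMetric
  exact ⟨⟨N, hdeg, hsmul, hleib⟩, (AffineConnection.isLeviCivita_iff _ _).2 ⟨htor, hmet⟩⟩

lemma AffineConnection.IsLeviCivita.unique {g : SuperMetric M} {D D' : AffineConnection M}
    (hD : D.IsLeviCivita g) (hD' : D'.IsLeviCivita g) : D = D' := by
  rw [AffineConnection.isLeviCivita_iff] at hD hD'
  exact AffineConnection.ext (leviCivita_unique g.isSuperMetric D.isConnection D'.isConnection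
    hD.1 hD'.1 hD.2 hD'.2)

variable {g : SuperMetric M} {P : M.Vect}

/-- The connection `∇ + c B`, for the tensor `B(X, Y) = X · g(Y, P)` and an integer `c`. -/
def AffineConnection.addTwist (D : AffineConnection M) (hP : HasDeg g.deg P) (c : ℤ) :
    AffineConnection M :=
  have h := D.isConnection.add_twistTensor g.isSuperMetric hP c
  ⟨D.nabla + c • twistTensor (g.form ⊤) P, h.deg, h.smul_left, h.leibniz⟩

lemma AffineConnection.addTwist_nabla (D : AffineConnection M) (hP : HasDeg g.deg P) (c : ℤ)
    {i j : ZMod 2} {X Y : M.Vect} (hX : HasDeg i X) (hY : HasDeg j Y) :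
    (D.addTwist hP c).nabla X Y = D.nabla X Y + c • twist (g.form ⊤) P i j X Y := by
  rw [← twistTensor_of_mem hX hY]
  rfl

lemma isSemiSymmetricNonMetric_iff (hP : HasDeg g.deg P) (D : AffineConnection M) :
    D.HasSemiSymmetricTorsion g P ∧ D.HasNonMetricity g P ↔ D.IsSemiSymmetricNonMetric g P := by
  rw [D.hasSemiSymmetricTorsion_iff]
  constructor
  · rintro ⟨h1, h2⟩
    have h : ∀ (i j : ZMod 2) (X Y : M.Vect), HasDeg i X → HasDeg j Y →
        D.nabla X Y = (D.addTwist hP (-1)).nabla X Y + twist (g.form ⊤) P i j X Y := by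
      intro i j X Y hX hY
      rw [D.addTwist_nabla hP _ hX hY]
      ext a
      rw [coe_add_apply, coe_add_apply, coe_zsmul_apply, neg_one_smul, neg_add_cancel_right]
    -- The only candidate for the Levi-Civita connection is `D` with the twist subtracted.
    exact ⟨D.addTwist hP (-1), (AffineConnection.isLeviCivita_iff _ _).2
      ⟨(hasSemiTorsion_iff h).1 h1, (hasSemiNonMetricity_iff g.isSuperMetric hP h).1 h2⟩, h⟩
  · rintro ⟨L, hL, h⟩
    rw [AffineConnection.isLeviCivita_iff] at hL
    exact ⟨(hasSemiTorsion_iff h).2 hL.1, (hasSemiNonMetricity_iff g.isSuperMetric hP h).2 hL.2⟩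

lemma existsUnique_semiSymmetricNonMetric (hP : HasDeg g.deg P) :
    ∃! D : AffineConnection M, D.HasSemiSymmetricTorsion g P ∧ D.HasNonMetricity g P := by
  simp only [isSemiSymmetricNonMetric_iff hP]
  obtain ⟨L, hL⟩ := g.exists_leviCivita
  refine ⟨L.addTwist hP 1, ⟨L, hL, fun i j X Y hX hY => ?_⟩, ?_⟩
  · rw [L.addTwist_nabla hP _ hX hY]
    exact congrArg _ (one_smul ℤ (twist (g.form ⊤) P i j X Y))
  · rintro D ⟨L', hL', h⟩
    obtain rfl := hL'.unique hL
    refine AffineConnection.ext (addHom_ext_of_homogeneous fun i X hX =>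
      addHom_ext_of_homogeneous fun j Y hY => ?_)
    rw [L'.addTwist_nabla hP _ hX hY, h i j X Y hX hY]
    exact congrArg _ (one_smul ℤ (twist (g.form ⊤) P i j X Y)).symm

end Connections

/-! ### Derivations of `C^∞(W) ⊗ Λ ℝ^n` -/

section Smooth

variable {m : ℕ} {V W : Opens (E m)}

/-- Extension by zero of a function on an open subset. -/
def extendZero (f : W → ℝ) (x : E m) : ℝ := by
  classical exact if h : x ∈ W then f ⟨x, h⟩ else 0

lemma extendZero_coe (f : W → ℝ) (x : W) : extendZero f x = f x := by
  simp [extendZero]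

lemma extendZero_of_mem (f : W → ℝ) {x : E m} (hx : x ∈ W) : extendZero f x = f ⟨x, hx⟩ := by
  simp [extendZero, hx]

lemma contDiffAt_extendZero (f : C^∞⟮𝓘(ℝ, E m), W; ℝ⟯) (x : W) :
    ContDiffAt ℝ ∞ (extendZero f) (x : E m) := by
  rw [← contMDiffAt_iff_contDiffAt, ← contMDiffAt_subtype_iff]
  have h : (fun x : W => extendZero f x) = f := funext (extendZero_coe f)
  rw [h]
  exact f.contMDiff x

/-- As `W` is open, derivatives at its points do not depend on the extension, so any convenient `F`
may be differentiated in place of the extension by zero. -/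
lemma eventuallyEq_extendZero {f : W → ℝ} {F : E m → ℝ} (h : ∀ x : W, F x = f x) (x : W) :
    extendZero f =ᶠ[nhds (x : E m)] F := by
  filter_upwards [W.isOpen.mem_nhds x.2] with y hy
  rw [extendZero_of_mem f hy, ← h ⟨y, hy⟩]

/-- The derivative in the direction `v`, on smooth functions on an open subset of `ℝ^m`. -/
def partialDeriv (v : E m) (f : C^∞⟮𝓘(ℝ, E m), W; ℝ⟯) : C^∞⟮𝓘(ℝ, E m), W; ℝ⟯ :=
  ⟨fun x => fderiv ℝ (extendZero f) x v, fun x => by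
    rw [contMDiffAt_subtype_iff (f := fun x => fderiv ℝ (extendZero f) x v),
      contMDiffAt_iff_contDiffAt]
    exact ((contDiffAt_extendZero f x).fderiv_right (m := ∞) (by simp)).clm_apply
      contDiffAt_const⟩

lemma partialDeriv_apply (v : E m) (f : C^∞⟮𝓘(ℝ, E m), W; ℝ⟯) (x : W) :
    partialDeriv v f x = fderiv ℝ (extendZero f) x v := rfl

lemma partialDeriv_apply_of_eq (v : E m) (f : C^∞⟮𝓘(ℝ, E m), W; ℝ⟯) {F : E m → ℝ}
    (h : ∀ x : W, F x = f x) (x : W) : partialDeriv v f x = fderiv ℝ F x v := by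
  rw [partialDeriv_apply, (eventuallyEq_extendZero h x).fderiv_eq]

lemma differentiableAt_extendZero (f : C^∞⟮𝓘(ℝ, E m), W; ℝ⟯) (x : W) :
    DifferentiableAt ℝ (extendZero f) (x : E m) :=
  (contDiffAt_extendZero f x).differentiableAt (by simp)

/-- The derivative in the direction `v` as a linear map. -/
def partialDerivLin (v : E m) : C^∞⟮𝓘(ℝ, E m), W; ℝ⟯ →ₗ[ℝ] C^∞⟮𝓘(ℝ, E m), W; ℝ⟯ where
  toFun := partialDeriv v
  map_add' f g := by
    ext x
    rw [partialDeriv_apply_of_eq v (f + g) (F := extendZero f + extendZero g)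
      (fun x => by simp [extendZero_coe]),
      fderiv_add (differentiableAt_extendZero f x) (differentiableAt_extendZero g x)]
    rfl
  map_smul' c f := by
    ext x
    rw [partialDeriv_apply_of_eq v (c • f) (F := c • extendZero f)
      (fun x => by simp [extendZero_coe]),
      fderiv_const_smul (differentiableAt_extendZero f x)]
    rfl

lemma partialDerivLin_mul (v : E m) (f g : C^∞⟮𝓘(ℝ, E m), W; ℝ⟯) :
    partialDerivLin v (f * g) = partialDerivLin v f * g + f * partialDerivLin v g := by
  ext x
  change partialDeriv v (f * g) x = partialDeriv v f x * g x + f x * partialDeriv v g x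
  rw [partialDeriv_apply_of_eq v (f * g) (F := extendZero f * extendZero g)
      (fun x => by simp [extendZero_coe]),
      fderiv_mul (differentiableAt_extendZero f x) (differentiableAt_extendZero g x),
      partialDeriv_apply, partialDeriv_apply]
  simp [extendZero_coe]
  ring

lemma partialDerivLin_one (v : E m) :
    partialDerivLin v (1 : C^∞⟮𝓘(ℝ, E m), W; ℝ⟯) = 0 := by
  simpa using partialDerivLin_mul v (1 : C^∞⟮𝓘(ℝ, E m), W; ℝ⟯) 1

lemma smoothRes_apply (h : V ≤ W) (f : C^∞⟮𝓘(ℝ, E m), W; ℝ⟯) (x : V) :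
    smoothRes h f x = f ⟨x, h x.2⟩ := rfl

lemma smoothRes_partialDerivLin (h : V ≤ W) (v : E m) (f : C^∞⟮𝓘(ℝ, E m), W; ℝ⟯) :
    smoothRes h (partialDerivLin v f) = partialDerivLin v (smoothRes h f) := by
  ext x
  rw [smoothRes_apply]
  change partialDeriv v f _ = partialDeriv v (smoothRes h f) x
  rw [partialDeriv_apply_of_eq v (smoothRes h f) (F := extendZero f)
    (fun y => by rw [smoothRes_apply, extendZero_of_mem f (h y.2)]), partialDeriv_apply]

/-- The `i`-th coordinate function. -/
def coordFn (i : Fin m) : C^∞⟮𝓘(ℝ, E m), W; ℝ⟯ :=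
  ⟨fun x => (EuclideanSpace.proj i : E m →L[ℝ] ℝ) x, fun x => by
    rw [contMDiffAt_subtype_iff (f := (EuclideanSpace.proj i : E m →L[ℝ] ℝ)),
      contMDiffAt_iff_contDiffAt]
    exact (EuclideanSpace.proj i : E m →L[ℝ] ℝ).contDiff.contDiffAt⟩

lemma partialDerivLin_coordFn (i : Fin m) :
    partialDerivLin (EuclideanSpace.single i 1) (coordFn i : C^∞⟮𝓘(ℝ, E m), W; ℝ⟯) = 1 := by
  ext x
  change partialDeriv _ _ x = 1
  rw [partialDeriv_apply_of_eq _ _ (F := (EuclideanSpace.proj i : E m →L[ℝ] ℝ)) (fun x => rfl),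
    ContinuousLinearMap.fderiv]
  simp

end Smooth

/-! ### Contraction as an odd derivation of the exterior algebra -/

section Contraction

variable {n : ℕ}

/-- The quadratic form `0`, whose Clifford algebra is the exterior algebra. -/
abbrev zeroForm (n : ℕ) : QuadraticForm ℝ (Fin n → ℝ) := 0

open CliffordAlgebra

/-- The grading involution carries the sign of the odd Leibniz rule, so `a` need not be homogeneous
and can be built up by left multiplication with vectors. -/
lemma contractLeft_mul_involute (d : Module.Dual ℝ (Fin n → ℝ))
    (a b : CliffordAlgebra (zeroForm n)) :
    contractLeft d (a * b) = contractLeft d a * b + involute a * contractLeft d b := by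
  induction a using CliffordAlgebra.left_induction with
  | algebraMap r =>
    rw [contractLeft_algebraMap, AlgHom.commutes, contractLeft_algebraMap_mul]
    simp
  | add x y hx hy =>
    rw [add_mul, map_add, hx, hy, map_add, map_add, add_mul, add_mul]
    abel
  | ι_mul x v hx =>
    rw [mul_assoc, contractLeft_ι_mul, hx, contractLeft_ι_mul, map_mul, involute_ι]
    simp only [mul_add, sub_mul, smul_mul_assoc, neg_mul, mul_assoc]
    abel

lemma contractLeft_mul (d : Module.Dual ℝ (Fin n → ℝ)) (j : ZMod 2)
    {a : CliffordAlgebra (zeroForm n)} (ha : a ∈ evenOdd (zeroForm n) j)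
    (b : CliffordAlgebra (zeroForm n)) :
    contractLeft d (a * b) = contractLeft d a * b + sgn 1 j • (a * contractLeft d b) := by
  rw [contractLeft_mul_involute]
  rcases parity_cases j with rfl | rfl
  · rw [involute_eq_of_mem_even ha, sgn_zero_right, one_smul]
  · rw [involute_eq_of_mem_odd ha, sgn_one_one, neg_smul, one_smul, neg_mul]

lemma contractLeft_mem (d : Module.Dual ℝ (Fin n → ℝ)) (j : ZMod 2)
    {a : CliffordAlgebra (zeroForm n)} (ha : a ∈ evenOdd (zeroForm n) j) :
    contractLeft d a ∈ evenOdd (zeroForm n) (1 + j) := by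
  have hι : ∀ v, ι (zeroForm n) v ∈ evenOdd (zeroForm n) 1 := ι_mem_evenOdd_one _
  induction a, ha using CliffordAlgebra.evenOdd_induction with
  | range_ι_pow v h =>
    rcases parity_cases j with rfl | rfl
    · simp only [ZMod.val_zero, pow_zero, Submodule.mem_one] at h
      obtain ⟨r, rfl⟩ := h
      rw [contractLeft_algebraMap]
      exact zero_mem _
    · rw [show (1 : ZMod 2).val = 1 from rfl, pow_one] at h
      obtain ⟨w, rfl⟩ := h
      rw [contractLeft_ι, parity_one_add_one, Algebra.algebraMap_eq_smul_one]
      exact Submodule.smul_mem _ _ (SetLike.GradedOne.one_mem (A := evenOdd (zeroForm n)))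
  | add x y hx hy ihx ihy =>
    rw [map_add]
    exact add_mem ihx ihy
  | ι_mul_ι_mul v w x hx ih =>
    rw [mul_assoc, contractLeft_ι_mul, contractLeft_ι_mul, mul_sub]
    have h1 : ∀ v, ι (zeroForm n) v * x ∈ evenOdd (zeroForm n) (1 + j) := fun v =>
      SetLike.GradedMul.mul_mem (A := evenOdd (zeroForm n)) (hι v) hx
    have h2 : ι (zeroForm n) v * (ι (zeroForm n) w * contractLeft d x) ∈
        evenOdd (zeroForm n) (1 + (1 + (1 + j))) :=
      SetLike.GradedMul.mul_mem (A := evenOdd (zeroForm n)) (hι v)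
        (SetLike.GradedMul.mul_mem (A := evenOdd (zeroForm n)) (hι w) ih)
    rw [show (1 : ZMod 2) + (1 + (1 + j)) = 1 + j by
      rw [← add_assoc, parity_one_add_one, zero_add]] at h2
    refine sub_mem (Submodule.smul_mem _ _ (h1 w)) (sub_mem ?_ h2)
    rw [mul_smul_comm]
    exact Submodule.smul_mem _ _ (h1 v)

end Contraction

/-! ### Coordinate derivations of the local model -/

section ModelDerivations

variable {m n : ℕ} {V W : Opens (E m)}

lemma modelGr_induction {j : ZMod 2} {p : Model m n W → Prop} (h0 : p 0)
    (hadd : ∀ a b, p a → p b → p (a + b))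
    (h : ∀ (f : C^∞⟮𝓘(ℝ, E m), W; ℝ⟯), ∀ τ ∈ CliffordAlgebra.evenOdd (zeroForm n) j,
      p (f ⊗ₜ[ℝ] τ))
    {a : Model m n W} (ha : a ∈ modelGr m n W j) : p a := by
  obtain ⟨t, rfl⟩ := ha
  induction t using TensorProduct.induction_on with
  | zero => rw [map_zero]; exact h0
  | tmul f τ => exact h f τ.1 τ.2
  | add x y hx hy => rw [map_add]; exact hadd _ _ hx hy

lemma tmul_mem_modelGr {j : ZMod 2} (f : C^∞⟮𝓘(ℝ, E m), W; ℝ⟯)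
    {τ : ExteriorAlgebra ℝ (Fin n → ℝ)} (hτ : τ ∈ CliffordAlgebra.evenOdd (zeroForm n) j) :
    (f ⊗ₜ[ℝ] τ : Model m n W) ∈ modelGr m n W j :=
  ⟨f ⊗ₜ ⟨τ, hτ⟩, rfl⟩

lemma exists_modelGr_add (a : Model m n W) :
    ∃ F : ZMod 2 → Model m n W, (∀ i, F i ∈ modelGr m n W i) ∧ a = F 0 + F 1 := by
  induction a using TensorProduct.induction_on with
  | zero => exact ⟨0, fun _ => zero_mem _, by simp⟩
  | tmul f τ =>
    have h : τ ∈ CliffordAlgebra.evenOdd (zeroForm n) 0 ⊔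
        CliffordAlgebra.evenOdd (zeroForm n) 1 := by
      rw [(CliffordAlgebra.evenOdd_isCompl (zeroForm n)).sup_eq_top]; trivial
    obtain ⟨τ₀, h₀, τ₁, h₁, rfl⟩ := Submodule.mem_sup.1 h
    refine ⟨fun i => if i = 0 then f ⊗ₜ τ₀ else f ⊗ₜ τ₁, fun i => ?_, ?_⟩
    · rcases parity_cases i with rfl | rfl
      · simpa using tmul_mem_modelGr f h₀
      · simpa using tmul_mem_modelGr f h₁
    · simp [TensorProduct.tmul_add]
  | add x y hx hy =>
    obtain ⟨F, hF, rfl⟩ := hx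
    obtain ⟨G, hG, rfl⟩ := hy
    exact ⟨F + G, fun i => add_mem (hF i) (hG i), by simp only [Pi.add_apply]; abel⟩

/-- A derivation of degree `i` of the algebra `C^∞(W) ⊗ Λ ℝ^n`. -/
structure IsModelDerivation (i : ZMod 2) (δ : Model m n W →ₗ[ℝ] Model m n W) : Prop where
  deg : ∀ j, ∀ a ∈ modelGr m n W j, δ a ∈ modelGr m n W (i + j)
  leibniz : ∀ j, ∀ a ∈ modelGr m n W j, ∀ b, δ (a * b) = δ a * b + sgn i j • (a * δ b)

variable (n) in
/-- The even derivation `∂_v ⊗ id`. -/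
def evenDeriv (v : E m) : Model m n W →ₗ[ℝ] Model m n W :=
  LinearMap.rTensor _ (partialDerivLin v)

lemma evenDeriv_tmul (v : E m) (f : C^∞⟮𝓘(ℝ, E m), W; ℝ⟯) (τ : ExteriorAlgebra ℝ (Fin n → ℝ)) :
    evenDeriv n v (f ⊗ₜ[ℝ] τ) = partialDerivLin v f ⊗ₜ[ℝ] τ := rfl

/-- The odd derivation `id ⊗ (d ⌋ ·)`. -/
def oddDeriv (d : Module.Dual ℝ (Fin n → ℝ)) : Model m n W →ₗ[ℝ] Model m n W :=
  LinearMap.lTensor _ (CliffordAlgebra.contractLeft (Q := zeroForm n) d)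

lemma oddDeriv_tmul (d : Module.Dual ℝ (Fin n → ℝ)) (f : C^∞⟮𝓘(ℝ, E m), W; ℝ⟯)
    (τ : ExteriorAlgebra ℝ (Fin n → ℝ)) :
    oddDeriv d (f ⊗ₜ[ℝ] τ : Model m n W) =
      f ⊗ₜ[ℝ] (CliffordAlgebra.contractLeft (Q := zeroForm n) d τ) := rfl

lemma isModelDerivation_evenDeriv (v : E m) :
    IsModelDerivation 0 (evenDeriv n v : Model m n W →ₗ[ℝ] Model m n W) := by
  refine ⟨fun j a ha => ?_, fun j a ha b => ?_⟩
  · refine modelGr_induction (p := fun a => evenDeriv n v a ∈ modelGr m n W (0 + j)) ?_ ?_ ?_ ha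
    · rw [map_zero]; exact zero_mem _
    · intro a b ha hb; rw [map_add]; exact add_mem ha hb
    · intro f τ hτ
      rw [zero_add]
      exact tmul_mem_modelGr _ hτ
  · rw [sgn_zero_left, one_smul]
    refine modelGr_induction
      (p := fun a => evenDeriv n v (a * b) = evenDeriv n v a * b + a * evenDeriv n v b)
      ?_ ?_ ?_ ha
    · simp
    · intro x y hx hy
      rw [add_mul, map_add, hx, hy, map_add, add_mul, add_mul]
      abel
    · intro f τ _
      induction b using TensorProduct.induction_on with
      | zero => simp
      | add x y hx hy =>
        rw [mul_add, map_add, hx, hy, map_add, mul_add, mul_add]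
        abel
      | tmul h η =>
        rw [Algebra.TensorProduct.tmul_mul_tmul, evenDeriv_tmul, evenDeriv_tmul, evenDeriv_tmul,
          Algebra.TensorProduct.tmul_mul_tmul, Algebra.TensorProduct.tmul_mul_tmul,
          partialDerivLin_mul, TensorProduct.add_tmul]

lemma isModelDerivation_oddDeriv (d : Module.Dual ℝ (Fin n → ℝ)) :
    IsModelDerivation 1 (oddDeriv d : Model m n W →ₗ[ℝ] Model m n W) := by
  refine ⟨fun j a ha => ?_, fun j a ha b => ?_⟩
  · refine modelGr_induction (p := fun a => oddDeriv d a ∈ modelGr m n W (1 + j)) ?_ ?_ ?_ ha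
    · rw [map_zero]; exact zero_mem _
    · intro a b ha hb; rw [map_add]; exact add_mem ha hb
    · intro f τ hτ
      exact tmul_mem_modelGr _ (contractLeft_mem d j hτ)
  · refine modelGr_induction
      (p := fun a => oddDeriv d (a * b) = oddDeriv d a * b + sgn 1 j • (a * oddDeriv d b))
      ?_ ?_ ?_ ha
    · simp
    · intro x y hx hy
      rw [add_mul, map_add, hx, hy, map_add, add_mul, add_mul, smul_add]
      abel
    · intro f τ hτ
      induction b using TensorProduct.induction_on with
      | zero => simp
      | add x y hx hy =>
        rw [mul_add, map_add, hx, hy, map_add, mul_add, mul_add, smul_add]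
        abel
      | tmul h η =>
        rw [Algebra.TensorProduct.tmul_mul_tmul, oddDeriv_tmul, oddDeriv_tmul, oddDeriv_tmul,
          Algebra.TensorProduct.tmul_mul_tmul, Algebra.TensorProduct.tmul_mul_tmul,
          contractLeft_mul d j hτ, TensorProduct.tmul_add, TensorProduct.tmul_smul]

end ModelDerivations

/-! ### Gluing of sections and extension by zero -/

namespace SuperRingedSpace

variable {M : SuperRingedSpace.{u}} {U O V : Opens M.carrier}

lemma res_res (h : V ≤ U) (h' : O ≤ V) (s : M.sec U) :
    M.res h' (M.res h s) = M.res (h'.trans h) s := by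
  have e : M.sheaf.presheaf.map (homOfLE (h'.trans h)).op =
      M.sheaf.presheaf.map (homOfLE h).op ≫ M.sheaf.presheaf.map (homOfLE h').op := by
    rw [← Functor.map_comp]; rfl
  change _ = (M.sheaf.presheaf.map (homOfLE (h'.trans h)).op).hom s
  rw [e]
  rfl

lemma res_mem (h : V ≤ U) {i : ZMod 2} {s : M.sec U} (hs : s ∈ M.gr U i) :
    M.res h s ∈ M.gr V i := M.map_gr h i s hs

lemma eq_of_res_eq_res (hUO : U ⊔ O = ⊤) {s t : M.sec ⊤}
    (hU : M.res le_top s = M.res (V := U) le_top t)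
    (hO : M.res le_top s = M.res (V := O) le_top t) : s = t :=
  M.sheaf.eq_of_locally_eq₂ (homOfLE (le_top : U ≤ ⊤)) (homOfLE (le_top : O ≤ ⊤)) hUO.ge s t hU hO

lemma eq_of_locally_res_eq {s t : M.sec ⊤}
    (h : ∀ p : M.carrier, ∃ V : Opens M.carrier, p ∈ V ∧ M.res (V := V) le_top s = M.res le_top t) :
    s = t := by
  choose V hV hst using h
  refine M.sheaf.eq_of_locally_eq' V ⊤ (fun p => homOfLE le_top) ?_ s t hst
  intro p _
  exact Opens.mem_iSup.2 ⟨p, hV p⟩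

lemma exists_glue (hUO : U ⊔ O = ⊤) (s : M.sec U) (t : M.sec O)
    (h : M.res (inf_le_left : U ⊓ O ≤ U) s = M.res (inf_le_right : U ⊓ O ≤ O) t) :
    ∃ r : M.sec ⊤, M.res le_top r = s ∧ M.res le_top r = t := by
  let F : Bool → Opens M.carrier := fun b => cond b U O
  let sf : ∀ b, M.sec (F b) := fun b => match b with
    | true => s
    | false => t
  have h' : M.res (inf_le_left : O ⊓ U ≤ O) t = M.res (inf_le_right : O ⊓ U ≤ U) s := by
    have h1 := congrArg (M.res (inf_comm O U).le) h
    rw [res_res, res_res] at h1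
    exact h1.symm
  obtain ⟨r, hr, -⟩ := M.sheaf.existsUnique_gluing' F ⊤ (fun b => homOfLE le_top)
    (by
      rw [← hUO]
      exact sup_le (le_iSup F true) (le_iSup F false)) sf
    (by
      rintro (_ | _) (_ | _)
      · rfl
      · exact h'
      · exact h
      · rfl)
  exact ⟨r, hr true, hr false⟩

/-- Parity is a local condition: the component of the other parity restricts to zero on both open
sets, hence is zero. -/
lemma mem_gr_of_res_mem (hUO : U ⊔ O = ⊤) {i : ZMod 2} {s : M.sec ⊤}
    (hU : M.res le_top s ∈ M.gr U i) (hO : M.res le_top s ∈ M.gr O i) : s ∈ M.gr ⊤ i := by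
  obtain ⟨a, ha, b, hb, rfl⟩ : ∃ a ∈ M.gr ⊤ i, ∃ b ∈ M.gr ⊤ (i + 1), s = a + b := by
    obtain ⟨s₀, h₀, s₁, h₁, rfl⟩ := exists_add_of_internal (𝒜 := M.gr ⊤) s
    rcases parity_cases i with rfl | rfl
    · exact ⟨s₀, h₀, s₁, by rwa [zero_add], rfl⟩
    · exact ⟨s₁, h₁, s₀, by rwa [parity_one_add_one], add_comm _ _⟩
  have hi : i + 1 ≠ i := by simp
  have hb0 : b = 0 := by
    refine eq_of_res_eq_res hUO ?_ ?_
    · rw [map_zero]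
      refine eq_zero_of_mem_of_mem (𝒜 := M.gr U) hi (res_mem _ hb) ?_
      rw [map_add] at hU
      exact (Submodule.add_mem_iff_right _ (res_mem _ ha)).1 hU
    · rw [map_zero]
      refine eq_zero_of_mem_of_mem (𝒜 := M.gr O) hi (res_mem _ hb) ?_
      rw [map_add] at hO
      exact (Submodule.add_mem_iff_right _ (res_mem _ ha)).1 hO
  rw [hb0, add_zero]
  exact ha

/-- Multiplication by a section that vanishes on `U ∩ O`, followed by extension by zero. -/
lemma exists_extension (hUO : U ⊔ O = ⊤) {ρ : M.sec U}
    (hρ : M.res (inf_le_left : U ⊓ O ≤ U) ρ = 0) :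
    ∃ e : M.sec U →ₗ[ℝ] M.sec ⊤, (∀ s, M.res le_top (e s) = ρ * s) ∧
      ∀ s, M.res (V := O) le_top (e s) = 0 := by
  have h : ∀ s : M.sec U, ∃ r : M.sec ⊤, M.res le_top r = ρ * s ∧ M.res (V := O) le_top r = 0 :=
    fun s => exists_glue hUO _ _ (by rw [map_mul, hρ, zero_mul, map_zero])
  choose e he he' using h
  refine ⟨⟨⟨e, fun s t => ?_⟩, fun c s => ?_⟩, he, he'⟩
  · refine eq_of_res_eq_res hUO ?_ ?_
    · rw [map_add, he, he, he, mul_add]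
    · rw [map_add, he', he', he', add_zero]
  · refine eq_of_res_eq_res hUO ?_ ?_
    · rw [RingHom.id_apply, map_smul, he, he, mul_smul_comm]
    · rw [RingHom.id_apply, map_smul, he', he', smul_zero]

section Extension

variable {ρ : M.sec U} {e : M.sec U →ₗ[ℝ] M.sec ⊤}

lemma extension_mem (hUO : U ⊔ O = ⊤) (hρ : ρ ∈ M.gr U 0)
    (he : ∀ s, M.res le_top (e s) = ρ * s) (he' : ∀ s, M.res (V := O) le_top (e s) = 0)
    {i : ZMod 2} {s : M.sec U} (hs : s ∈ M.gr U i) : e s ∈ M.gr ⊤ i := by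
  refine mem_gr_of_res_mem hUO ?_ ?_
  · rw [he]
    simpa using SetLike.GradedMul.mul_mem hρ hs
  · rw [he']
    exact zero_mem _

/-- The Leibniz rule is checked over the cover. On `U` it is the rule for `δ` times the even, hence
central, section `ρ`; on `O` both sides vanish. -/
lemma extension_derivation_mem (hUO : U ⊔ O = ⊤) (hρ : ρ ∈ M.gr U 0)
    (he : ∀ s, M.res le_top (e s) = ρ * s) (he' : ∀ s, M.res (V := O) le_top (e s) = 0)
    {i : ZMod 2} {δ : M.sec U →ₗ[ℝ] M.sec U} (hδ : δ ∈ derDeg (M.gr U) i) :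
    e ∘ₗ δ ∘ₗ (M.res (le_top : U ≤ ⊤)).toLinearMap ∈ derDeg (M.gr ⊤) i := by
  refine ⟨fun j a ha => ?_, fun j a ha b => ?_⟩
  · exact extension_mem hUO hρ he he' (hδ.1 _ _ (res_mem _ ha))
  · simp only [LinearMap.comp_apply, AlgHom.toLinearMap_apply]
    refine eq_of_res_eq_res hUO ?_ ?_
    · have hc : M.res le_top a * ρ = ρ * M.res le_top a := by
        rw [SuperCommAlg.super_comm _ _ _ (res_mem _ ha) _ hρ, sgn_zero_right, one_smul]
      rw [he, map_mul (M.res (le_top : U ≤ ⊤)) a b, hδ.2 _ _ (res_mem _ ha),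
        map_add, map_zsmul, map_mul (M.res (le_top : U ≤ ⊤)) _ b,
        map_mul (M.res (le_top : U ≤ ⊤)) a, he, he, mul_add, mul_smul_comm,
        ← mul_assoc, ← mul_assoc, ← mul_assoc, hc]
    · rw [he', map_add, map_zsmul, map_mul (M.res (le_top : O ≤ ⊤)) _ b,
        map_mul (M.res (le_top : O ≤ ⊤)) a, he', he', zero_mul, mul_zero, smul_zero,
        add_zero]

/-- Near a point where the cutoff function is `1`, the extended derivation takes the extended
function to the expected value. -/
lemma res_extension_derivation (hρ : ρ ∈ M.gr U 0)
    (he : ∀ s, M.res le_top (e s) = ρ * s) {i : ZMod 2} {δ : M.sec U →ₗ[ℝ] M.sec U}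
    (hδ : δ ∈ derDeg (M.gr U) i) (hV : V ≤ U) (h1 : M.res hV ρ = 1) (h0 : M.res hV (δ ρ) = 0)
    (x : M.sec U) :
    M.res le_top ((e ∘ₗ δ ∘ₗ (M.res (le_top : U ≤ ⊤)).toLinearMap) (e x)) = M.res hV (δ x) := by
  rw [← res_res le_top hV]
  simp only [LinearMap.comp_apply, AlgHom.toLinearMap_apply]
  rw [he, he, hδ.2 _ _ hρ, sgn_zero_right, one_smul, map_mul, map_add, map_mul, map_mul, h1, h0,
    zero_mul, zero_add, one_mul, one_mul]

end Extension

end SuperRingedSpace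

/-! ### Derivations in a superchart -/

namespace SuperChart

open SuperRingedSpace

variable {M : SuperRingedSpace.{u}} {m n : ℕ} (c : SuperChart M m n)

/-- The open subset of `M` that corresponds to `W ⊆ ℝ^m` in a superchart. -/
abbrev dom (W : Opens (E m)) : Opens M.carrier :=
  ⟨c.toHomeo.source ∩ c.toHomeo ⁻¹' W, c.toHomeo.isOpen_inter_preimage W.isOpen⟩

/-- The target of a superchart. -/
abbrev targetOpens : Opens (E m) := ⟨c.toHomeo.target, c.toHomeo.open_target⟩

variable {c} {W : Opens (E m)} (hW : (W : Set (E m)) ⊆ c.toHomeo.target)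

lemma dom_mono {V : Opens (E m)} (h : V ≤ W) : c.dom V ≤ c.dom W :=
  Set.inter_subset_inter_right _ (Set.preimage_mono h)

lemma res_iso {V : Opens (E m)} (h : V ≤ W) (a : Model m n W) :
    M.res (dom_mono h) (c.iso W hW a) = c.iso V (Set.Subset.trans h hW) (modelRes n h a) :=
  (c.iso_res V W h hW a).symm

/-- A superchart is only required to preserve parity from the model to `M`. For the converse, the
component of the wrong parity is mapped into both parities at once, so it is zero. -/
lemma symm_mem_modelGr {i : ZMod 2} {s : M.sec (c.dom W)} (hs : s ∈ M.gr (c.dom W) i) :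
    (c.iso W hW).symm s ∈ modelGr m n W i := by
  obtain ⟨F, hF, hs'⟩ := exists_modelGr_add ((c.iso W hW).symm s)
  have hsum : (c.iso W hW).symm s = F i + F (i + 1) := by
    rcases parity_cases i with rfl | rfl
    · rw [hs', zero_add]
    · rw [hs', parity_one_add_one, add_comm]
  have h : s = c.iso W hW (F i) + c.iso W hW (F (i + 1)) := by
    rw [← map_add, ← hsum, AlgEquiv.apply_symm_apply]
  have hz : c.iso W hW (F (i + 1)) = 0 := by
    refine eq_zero_of_mem_of_mem (𝒜 := M.gr (c.dom W)) (i := i + 1) (j := i) (by simp)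
      (c.iso_gr W hW _ _ (hF _)) ?_
    rw [h] at hs
    exact (Submodule.add_mem_iff_right _ (c.iso_gr W hW _ _ (hF _))).1 hs
  rw [hsum, (map_eq_zero_iff _ (c.iso W hW).injective).1 hz, add_zero]
  exact hF i

/-- Transport of a linear endomorphism along a superchart. -/
def transport (δ : Model m n W →ₗ[ℝ] Model m n W) : M.sec (c.dom W) →ₗ[ℝ] M.sec (c.dom W) :=
  (c.iso W hW).toLinearMap ∘ₗ δ ∘ₗ (c.iso W hW).symm.toLinearMap

lemma transport_iso (δ : Model m n W →ₗ[ℝ] Model m n W) (a : Model m n W) :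
    transport hW δ (c.iso W hW a) = c.iso W hW (δ a) := by
  simp [transport]

lemma transport_mem {i : ZMod 2} {δ : Model m n W →ₗ[ℝ] Model m n W}
    (hδ : IsModelDerivation i δ) : transport (c := c) hW δ ∈ derDeg (M.gr (c.dom W)) i := by
  refine ⟨fun j a ha => c.iso_gr W hW _ _ (hδ.deg _ _ (symm_mem_modelGr hW ha)), fun j a ha b => ?_⟩
  obtain ⟨a, rfl⟩ := (c.iso W hW).surjective a
  obtain ⟨b, rfl⟩ := (c.iso W hW).surjective b
  have ha' := symm_mem_modelGr hW ha
  rw [AlgEquiv.symm_apply_apply] at ha'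
  rw [← map_mul, transport_iso, transport_iso, transport_iso, hδ.leibniz j a ha', map_add,
    map_zsmul, map_mul, map_mul]

end SuperChart

/-! ### Vanishing of `g(-, P)` from the existence of coordinate derivations -/

section Vanishing

variable {A B : Type u} [Ring A] [Algebra ℝ A] {𝒜 : ZMod 2 → Submodule ℝ A} [SuperCommAlg 𝒜]
  [Ring B] [Algebra ℝ B] {d : ZMod 2} {g : der 𝒜 →+ der 𝒜 →+ A} {P : der 𝒜}

lemma mul_apply_add_eq_zero
    (H : ∀ (j k : ZMod 2) (Y Z : der 𝒜), Y.1 ∈ derDeg 𝒜 j → Z.1 ∈ derDeg 𝒜 k →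
      g Y P • Z + sgn j k • g Z P • Y = 0) {j k : ZMod 2} {Y Z : der 𝒜}
    (hY : Y.1 ∈ derDeg 𝒜 j) (hZ : Z.1 ∈ derDeg 𝒜 k) (h : A) :
    g Y P * Z.1 h + sgn j k • (g Z P * Y.1 h) = 0 :=
  LinearMap.congr_fun (congrArg Subtype.val (H j k Y Z hY hZ)) h

/-- The identity for `Y` and `D`, evaluated at `h` and mapped by `r`, reads `r(g(Y, P)) · 1 + 0 =
0`. In the application `r` is restriction to a neighbourhood and `D`, `h` are a coordinate field and
its coordinate. -/
lemma map_form_eq_zero_of_frame (r : A →ₐ[ℝ] B)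
    (H : ∀ (j k : ZMod 2) (Y Z : der 𝒜), Y.1 ∈ derDeg 𝒜 j → Z.1 ∈ derDeg 𝒜 k →
      g Y P • Z + sgn j k • g Z P • Y = 0) {k : ZMod 2} {D : der 𝒜} (hD : D.1 ∈ derDeg 𝒜 k)
    {h : A} (h1 : r (D.1 h) = 1) (h0 : r (g D P) = 0) (Y : der 𝒜) : r (g Y P) = 0 := by
  have key : ∀ (j : ZMod 2) (Y : der 𝒜), Y.1 ∈ derDeg 𝒜 j → r (g Y P) = 0 := by
    intro j Y hY
    have h2 := congrArg r (mul_apply_add_eq_zero H hY hD h)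
    rw [map_add, map_zsmul, map_mul, map_mul, h1, h0, zero_mul, smul_zero, add_zero, mul_one,
      map_zero] at h2
    exact h2
  obtain ⟨Y₀, Y₁, hY₀, hY₁, rfl⟩ := exists_homogeneous_add Y
  rw [map_add, AddMonoidHom.add_apply, map_add, key _ _ hY₀, key _ _ hY₁, add_zero]

/-- The case of an even coordinate. -/
lemma map_form_eq_zero_of_even (r : A →ₐ[ℝ] B)
    (H : ∀ (j k : ZMod 2) (Y Z : der 𝒜), Y.1 ∈ derDeg 𝒜 j → Z.1 ∈ derDeg 𝒜 k →
      g Y P • Z + sgn j k • g Z P • Y = 0) {D : der 𝒜} (hD : D.1 ∈ derDeg 𝒜 0)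
    {h : A} (h1 : r (D.1 h) = 1) (Y : der 𝒜) : r (g Y P) = 0 := by
  refine map_form_eq_zero_of_frame r H hD h1 (two_zsmul_cancel ?_) Y
  -- For `Y = Z = D` even, the two summands coincide and give `2 g(D, P)`. For odd `D` they would
  -- cancel.
  have h2 := congrArg r (mul_apply_add_eq_zero H hD hD h)
  rw [map_add, map_zsmul, map_mul, h1, mul_one, sgn_zero_left, one_smul, map_zero] at h2
  rw [two_smul, h2, smul_zero]

/-- The case of two odd coordinates. -/
lemma map_form_eq_zero_of_odd (r : A →ₐ[ℝ] B)
    (H : ∀ (j k : ZMod 2) (Y Z : der 𝒜), Y.1 ∈ derDeg 𝒜 j → Z.1 ∈ derDeg 𝒜 k →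
      g Y P • Z + sgn j k • g Z P • Y = 0) {D D' : der 𝒜} (hD : D.1 ∈ derDeg 𝒜 1)
    (hD' : D'.1 ∈ derDeg 𝒜 1) {h h' : A} (h1 : r (D.1 h) = 1) (h1' : r (D'.1 h') = 1)
    (h0 : r (D.1 h') = 0) (Y : der 𝒜) : r (g Y P) = 0 := by
  refine map_form_eq_zero_of_frame r H hD h1 ?_ Y
  -- Evaluation at `h'`, which `D'` sends to 1 and `D` to 0 after restriction, isolates `g(D, P)`.
  have h2 := congrArg r (mul_apply_add_eq_zero H hD hD' h')
  rwa [map_add, map_zsmul, map_mul, map_mul, h1', h0, mul_one, mul_zero, smul_zero, add_zero,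
    map_zero] at h2

lemma der_apply_mul_of_even (Y : der 𝒜) {f : A} (hf : f ∈ 𝒜 0) (k : A) :
    Y.1 (f * k) = Y.1 f * k + f * Y.1 k := by
  obtain ⟨Y₀, Y₁, hY₀, hY₁, rfl⟩ := exists_homogeneous_add Y
  simp only [coe_add_apply]
  rw [hY₀.2 _ _ hf, hY₁.2 _ _ hf, sgn_zero_right, sgn_zero_right, one_smul, one_smul, add_mul,
    mul_add]
  abel

lemma mul_comm_of_even {f : A} (hf : f ∈ 𝒜 0) (k : A) : f * k = k * f := by
  obtain ⟨k₀, hk₀, k₁, hk₁, rfl⟩ := exists_add_of_internal (𝒜 := 𝒜) k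
  rw [mul_add, add_mul, SuperCommAlg.super_comm _ _ _ hf _ hk₀,
    SuperCommAlg.super_comm _ _ _ hf _ hk₁, sgn_zero_left, sgn_zero_left, one_smul, one_smul]

/-- Leibniz gives `Y f = 2 f (Y f)`. Multiplying by `f` yields `f (Y f) = 2 f (Y f)`, so `f (Y f) =
0` and hence `Y f = 0`. -/
lemma der_apply_idempotent (Y : der 𝒜) {f : A} (hf : f ∈ 𝒜 0) (hff : f * f = f) :
    Y.1 f = 0 := by
  have h := der_apply_mul_of_even Y hf f
  rw [hff, ← mul_comm_of_even hf] at h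
  have h2 : f * Y.1 f = 0 := by
    have h3 := congrArg (f * ·) h
    simp only [mul_add, ← mul_assoc, hff] at h3
    exact left_eq_add.1 h3
  rw [h, h2, add_zero]

lemma mul_der_apply (Y : der 𝒜) {f : A} (hf : f ∈ 𝒜 0) (hff : f * f = f) (k : A) :
    f * Y.1 k = Y.1 (f * k) := by
  rw [der_apply_mul_of_even Y hf, der_apply_idempotent Y hf hff, zero_mul, zero_add]

/-- If the sections at an isolated point are constants, then there are no superderivations at that
point. -/
lemma mul_form_eq_zero_of_const (hg : IsSuperMetric 𝒜 d g) {f : A} (hf : f ∈ 𝒜 0)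
    (hff : f * f = f) (hk : ∀ k : A, ∃ a : ℝ, f * k = a • f) (Y : der 𝒜) : f * g Y P = 0 := by
  have h : f • Y = 0 := by
    ext k
    obtain ⟨a, ha⟩ := hk k
    rw [coe_smul_apply, mul_der_apply Y hf hff, ha, map_smul, der_apply_idempotent Y hf hff,
      smul_zero]
    rfl
  rw [← hg.smul, h, map_zero, AddMonoidHom.zero_apply]

/-- At an isolated point with one odd coordinate, graded symmetric forms vanish. -/
lemma mul_form_eq_zero_of_one_odd (hg : IsSuperMetric 𝒜 d g) (hP : P.1 ∈ derDeg 𝒜 d) {f : A}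
    (hf : f ∈ 𝒜 0) (hff : f * f = f) {D : der 𝒜} (hD : D.1 ∈ derDeg 𝒜 1) {h : A}
    (hh : h ∈ 𝒜 1) (hDh : f * D.1 h = f)
    (hk : ∀ k : A, ∃ a b : ℝ, f * k = a • f + b • (f * h)) (Y : der 𝒜) : f * g Y P = 0 := by
  -- On the piece cut out by `f` the algebra is spanned by 1 and `h`. A derivation kills the first,
  -- so it is determined by its value on `h` and is a multiple of `D`.
  have hY : ∀ Y : der 𝒜, f • Y = (f * Y.1 h) • D := by
    intro Y
    ext k
    obtain ⟨a, b, hab⟩ := hk k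
    have e : ∀ Y : der 𝒜, f * Y.1 k = b • (f * Y.1 h) := by
      intro Y
      rw [mul_der_apply Y hf hff, hab, map_add, map_smul, map_smul, der_apply_idempotent Y hf hff,
        smul_zero, zero_add, mul_der_apply Y hf hff]
    rw [coe_smul_apply, coe_smul_apply, e, mul_comm_of_even hf (Y.1 h), mul_assoc, e, hDh,
      mul_smul_comm]
  -- Graded symmetry on two odd arguments is antisymmetry.
  have hDD : g D D = 0 := by
    refine two_zsmul_cancel ?_
    have h2 := hg.symm _ _ _ _ hD hD
    rw [sgn_one_one, neg_one_smul] at h2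
    rw [two_smul, smul_zero]
    exact eq_neg_iff_add_eq_zero.1 h2
  have hDP : f * g D P = 0 := by
    have h2 := hg.smul_right hf hD P
    rw [sgn_zero_right, one_smul] at h2
    rw [← h2, hY P, hg.smul_right (SetLike.GradedMul.mul_mem hf (hP.1 _ _ hh)) hD, hDD, mul_zero,
      smul_zero]
  rw [← hg.smul, hY Y, hg.smul, mul_comm_of_even hf, mul_assoc, hDP, mul_zero]

end Vanishing

/-! ### Sections over a small-dimensional model -/

section SmallModels

variable {n : ℕ} {W : Opens (E 0)}

lemma exists_exteriorAlgebra_eq (hn : n ≤ 1) (τ : ExteriorAlgebra ℝ (Fin n → ℝ)) :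
    ∃ (r : ℝ) (v : Fin n → ℝ), τ = algebraMap ℝ _ r + ExteriorAlgebra.ι ℝ v := by
  have hsub : Subsingleton (Fin n) := by
    rcases Nat.le_one_iff_eq_zero_or_eq_one.1 hn with rfl | rfl <;> infer_instance
  -- With at most one generator all vectors are multiples of the constant vector 1, whose square in
  -- the exterior algebra is zero.
  have hv : ∀ v w : Fin n → ℝ, ExteriorAlgebra.ι ℝ v * ExteriorAlgebra.ι ℝ w = 0 := by
    intro v w
    have e : ∀ v : Fin n → ℝ, v = (∑ i, v i) • (1 : Fin n → ℝ) := by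
      intro v
      ext i
      simp [Fintype.sum_subsingleton _ i]
    rw [e v, e w, map_smul, map_smul, smul_mul_smul_comm, ExteriorAlgebra.ι_sq_zero, smul_zero]
  induction τ using ExteriorAlgebra.induction with
  | algebraMap r => exact ⟨r, 0, by simp⟩
  | ι v => exact ⟨0, v, by simp⟩
  | add a b ha hb =>
    obtain ⟨r, v, rfl⟩ := ha
    obtain ⟨s, w, rfl⟩ := hb
    exact ⟨r + s, v + w, by rw [map_add, map_add]; abel⟩
  | mul a b ha hb =>
    obtain ⟨r, v, rfl⟩ := ha
    obtain ⟨s, w, rfl⟩ := hb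
    refine ⟨r * s, r • w + s • v, ?_⟩
    rw [add_mul, mul_add, mul_add, hv, add_zero, map_mul, map_add, map_smul, map_smul,
      ← Algebra.commutes s (ExteriorAlgebra.ι ℝ v), ← Algebra.smul_def,
      ← Algebra.smul_def, ← Algebra.smul_def, add_assoc]

lemma exists_model_eq (hn : n ≤ 1) (x : W) (a : Model 0 n W) :
    ∃ (r : ℝ) (v : Fin n → ℝ), a = algebraMap ℝ _ r + 1 ⊗ₜ[ℝ] ExteriorAlgebra.ι ℝ v := by
  induction a using TensorProduct.induction_on with
  | zero => exact ⟨0, 0, by simp⟩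
  | add a b ha hb =>
    obtain ⟨r, v, rfl⟩ := ha
    obtain ⟨s, w, rfl⟩ := hb
    exact ⟨r + s, v + w, by rw [map_add, map_add, TensorProduct.tmul_add]; abel⟩
  | tmul f τ =>
    obtain ⟨r, v, rfl⟩ := exists_exteriorAlgebra_eq hn τ
    obtain ⟨t, rfl⟩ : ∃ t : ℝ, f = t • (1 : C^∞⟮𝓘(ℝ, E 0), W; ℝ⟯) := by
      refine ⟨f x, ?_⟩
      ext y
      obtain rfl : y = x := Subsingleton.elim _ _
      simp
    refine ⟨t * r, t • v, ?_⟩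
    rw [TensorProduct.smul_tmul, map_smul, smul_add, TensorProduct.tmul_add, map_mul,
      Algebra.TensorProduct.algebraMap_apply, Algebra.TensorProduct.algebraMap_apply,
      Algebra.TensorProduct.tmul_mul_tmul, Algebra.algebraMap_eq_smul_one,
      Algebra.algebraMap_eq_smul_one, Algebra.algebraMap_eq_smul_one]
    simp only [TensorProduct.smul_tmul, TensorProduct.tmul_smul, mul_one, mul_smul_comm]
    rw [smul_comm t r]

end SmallModels

open SuperRingedSpace SuperChart

/-! ### Global coordinate derivations -/

/-- A superchart at `p` with a cutoff function `ρ₀` that is `1` near `p`, and the operator `e` of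
multiplication by `ρ₀` and extension by zero. -/
structure LocalExtension {m n : ℕ} (M : SuperManifold.{u} m n) (p : M.carrier) where
  c : SuperChart M.toSuperRingedSpace m n
  O : Opens M.carrier
  ρ₀ : C^∞⟮𝓘(ℝ, E m), c.targetOpens; ℝ⟯
  V₀ : Opens (E m)
  le : V₀ ≤ c.targetOpens
  mem : p ∈ c.dom V₀
  cover : c.dom c.targetOpens ⊔ O = ⊤
  one : smoothRes le ρ₀ = 1
  e : M.sec (c.dom c.targetOpens) →ₗ[ℝ] M.sec ⊤
  res_e : ∀ s, M.res le_top (e s) = c.iso c.targetOpens subset_rfl (ρ₀ ⊗ₜ[ℝ] 1) * s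
  res_e' : ∀ s, M.res (V := O) le_top (e s) = 0

lemma nonempty_localExtension {m n : ℕ} (M : SuperManifold.{u} m n) (p : M.carrier) :
    Nonempty (LocalExtension M p) := by
  obtain ⟨c, hp⟩ := M.exists_chart p
  have := M.t2
  obtain ⟨ε, hε, hball⟩ := Metric.isOpen_iff.1 c.toHomeo.open_target _ (c.toHomeo.map_source hp)
  -- The bump function is 1 on the ball of radius `ε / 4` and 0 outside that of radius `ε / 2`,
  -- whose closure stays inside the chart.
  let b : ContDiffBump (c.toHomeo p) := ⟨ε / 4, ε / 2, by positivity, by linarith⟩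
  have hcb : Metric.closedBall (c.toHomeo p) (ε / 2) ⊆ c.toHomeo.target :=
    (Metric.closedBall_subset_ball (by linarith)).trans hball
  let K : Set M.carrier := c.toHomeo.symm '' Metric.closedBall (c.toHomeo p) (ε / 2)
  -- The image of a compact ball is compact, hence closed since `M` is Hausdorff. So the complement
  -- of `K` is open and covers `M` together with the chart domain.
  have hK : IsClosed K := ((isCompact_closedBall _ _).image_of_continuousOn
    (c.toHomeo.continuousOn_symm.mono hcb)).isClosed
  let O : Opens M.carrier := ⟨Kᶜ, hK.isOpen_compl⟩
  let V₀ : Opens (E m) := ⟨Metric.ball (c.toHomeo p) (ε / 4), Metric.isOpen_ball⟩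
  have hV : V₀ ≤ c.targetOpens := fun x hx =>
    hball (Metric.ball_subset_ball (by linarith) hx)
  let ρ₀ : C^∞⟮𝓘(ℝ, E m), c.targetOpens; ℝ⟯ := ⟨fun x => b x, fun x => by
    rw [contMDiffAt_subtype_iff (f := b), contMDiffAt_iff_contDiffAt]
    exact b.contDiffAt⟩
  have hcover : c.dom c.targetOpens ⊔ O = ⊤ := by
    refine eq_top_iff.2 fun x _ => ?_
    by_cases hx : x ∈ K
    · left
      obtain ⟨y, hy, rfl⟩ := hx
      refine ⟨c.toHomeo.map_target (hcb hy), ?_⟩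
      change c.toHomeo (c.toHomeo.symm y) ∈ c.toHomeo.target
      rw [c.toHomeo.right_inv (hcb hy)]
      exact hcb hy
    · right
      exact hx
  have hone : smoothRes hV ρ₀ = 1 := by
    ext x
    exact b.one_of_mem_closedBall (Metric.ball_subset_closedBall x.2)
  -- The overlap of the chart domain with `O` lies over `W'`, where the bump function vanishes; this
  -- is the hypothesis for extending by zero.
  let W' : Opens (E m) := ⟨c.toHomeo.target \ Metric.closedBall (c.toHomeo p) (ε / 2),
    c.toHomeo.open_target.sdiff Metric.isClosed_closedBall⟩
  have hW' : W' ≤ c.targetOpens := fun x hx => hx.1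
  have hle : c.dom c.targetOpens ⊓ O ≤ c.dom W' := by
    rintro x ⟨⟨hx, hx'⟩, hxK⟩
    exact ⟨hx, hx', fun h => hxK ⟨_, h, c.toHomeo.left_inv hx⟩⟩
  have hzero : M.res (inf_le_left : c.dom c.targetOpens ⊓ O ≤ _)
      (c.iso c.targetOpens subset_rfl (ρ₀ ⊗ₜ[ℝ] 1)) = 0 := by
    have h0 : smoothRes hW' ρ₀ = 0 := by
      ext x
      refine b.zero_of_le_dist ?_
      exact (not_le.1 fun h => x.2.2 (Metric.mem_closedBall.2 h)).le
    have h1 : modelRes n hW' (ρ₀ ⊗ₜ[ℝ] 1) = 0 := by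
      change smoothRes hW' ρ₀ ⊗ₜ[ℝ] _ = 0
      rw [h0, TensorProduct.zero_tmul]
    rw [← res_res (dom_mono hW') hle, res_iso subset_rfl hW', h1, map_zero, map_zero]
  obtain ⟨e, he, he'⟩ := exists_extension hcover hzero
  exact ⟨⟨c, O, ρ₀, V₀, hV, ⟨hp, Metric.mem_ball_self (by positivity)⟩, hcover, hone, e, he, he'⟩⟩

namespace LocalExtension

variable {m n : ℕ} {M : SuperManifold.{u} m n} {p : M.carrier} (F : LocalExtension M p)

/-- The isomorphism of sections over the chart domain. -/
abbrev chartIso : Model m n F.c.targetOpens ≃ₐ[ℝ] M.sec (F.c.dom F.c.targetOpens) :=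
  F.c.iso F.c.targetOpens subset_rfl

lemma cutoff_mem : F.chartIso (F.ρ₀ ⊗ₜ[ℝ] 1) ∈ M.gr _ 0 :=
  F.c.iso_gr _ _ _ _ (tmul_mem_modelGr F.ρ₀
    (SetLike.GradedOne.one_mem (A := CliffordAlgebra.evenOdd (zeroForm n))))

lemma dom_le : F.c.dom F.V₀ ≤ F.c.dom F.c.targetOpens :=
  dom_mono F.le

lemma res_chartIso (a : Model m n F.c.targetOpens) :
    M.res F.dom_le (F.chartIso a) = F.c.iso F.V₀ F.le (modelRes n F.le a) :=
  res_iso subset_rfl F.le a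

/-- The global function given by an element of the model. -/
def lift (a : Model m n F.c.targetOpens) : M.Fn := F.e (F.chartIso a)

lemma lift_mem {i : ZMod 2} {a : Model m n F.c.targetOpens} (ha : a ∈ modelGr m n _ i) :
    F.lift a ∈ M.gr ⊤ i :=
  extension_mem F.cover F.cutoff_mem F.res_e F.res_e' (F.c.iso_gr _ _ _ _ ha)

/-- The global vector field given by a derivation of the model. -/
def liftDer {i : ZMod 2} {δ : Model m n F.c.targetOpens →ₗ[ℝ] Model m n F.c.targetOpens}
    (hδ : IsModelDerivation i δ) : M.Vect :=
  ⟨_, derDeg_le_der (extension_derivation_mem F.cover F.cutoff_mem F.res_e F.res_e'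
    (transport_mem (c := F.c) subset_rfl hδ))⟩

lemma hasDeg_liftDer {i : ZMod 2}
    {δ : Model m n F.c.targetOpens →ₗ[ℝ] Model m n F.c.targetOpens}
    (hδ : IsModelDerivation i δ) : HasDeg i (F.liftDer hδ) :=
  extension_derivation_mem F.cover F.cutoff_mem F.res_e F.res_e'
    (transport_mem (c := F.c) subset_rfl hδ)

/-- The Leibniz rule on `ρ₀ a` also produces `δ(ρ₀) a`. The hypothesis `h0` removes this term near
`p`, where moreover both cutoffs equal 1. -/
lemma res_liftDer_lift {i : ZMod 2}
    {δ : Model m n F.c.targetOpens →ₗ[ℝ] Model m n F.c.targetOpens}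
    (hδ : IsModelDerivation i δ) (h0 : modelRes n F.le (δ (F.ρ₀ ⊗ₜ[ℝ] 1)) = 0)
    (a : Model m n F.c.targetOpens) :
    M.res le_top ((F.liftDer hδ).1 (F.lift a)) = F.c.iso F.V₀ F.le (modelRes n F.le (δ a)) := by
  have h1 : M.res F.dom_le (F.chartIso (F.ρ₀ ⊗ₜ[ℝ] 1)) = 1 := by
    rw [res_chartIso]
    have : modelRes n F.le (F.ρ₀ ⊗ₜ[ℝ] 1) = 1 := by
      change smoothRes F.le F.ρ₀ ⊗ₜ[ℝ] _ = 1
      rw [F.one]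
      rfl
    rw [this, map_one]
  have h2 : M.res F.dom_le (transport (c := F.c) subset_rfl δ (F.chartIso (F.ρ₀ ⊗ₜ[ℝ] 1))) = 0 := by
    rw [transport_iso, res_chartIso, h0, map_zero]
  have h3 := res_extension_derivation F.cutoff_mem F.res_e
    (transport_mem (c := F.c) subset_rfl hδ) F.dom_le h1 h2 (F.chartIso a)
  rw [transport_iso, res_chartIso] at h3
  exact h3

/-- The global vector field that is `∂/∂xⁱ` near `p`. -/
def evenField (i : Fin m) : M.Vect :=
  F.liftDer (isModelDerivation_evenDeriv (n := n) (EuclideanSpace.single i (1 : ℝ)))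

lemma res_evenField (i : Fin m) :
    M.res (V := F.c.dom F.V₀) le_top ((F.evenField i).1 (F.lift (coordFn i ⊗ₜ[ℝ] 1))) = 1 := by
  rw [evenField, res_liftDer_lift, evenDeriv_tmul, partialDerivLin_coordFn]
  · rw [← Algebra.TensorProduct.one_def, map_one, map_one]
  · rw [evenDeriv_tmul]
    change smoothRes F.le _ ⊗ₜ[ℝ] _ = 0
    rw [smoothRes_partialDerivLin, F.one, partialDerivLin_one, TensorProduct.zero_tmul]

/-- The global odd vector field that contracts with `d` near `p`. -/
def oddField (d : Module.Dual ℝ (Fin n → ℝ)) : M.Vect :=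
  F.liftDer (isModelDerivation_oddDeriv (m := m) d)

/-- The global odd function given by a vector in `ℝ^n`. -/
def oddFn (v : Fin n → ℝ) : M.Fn := F.lift (1 ⊗ₜ[ℝ] ExteriorAlgebra.ι ℝ v)

lemma oddFn_mem (v : Fin n → ℝ) : F.oddFn v ∈ M.gr ⊤ 1 :=
  F.lift_mem (tmul_mem_modelGr _ (CliffordAlgebra.ι_mem_evenOdd_one (zeroForm n) v))

lemma res_oddField (d : Module.Dual ℝ (Fin n → ℝ)) (v : Fin n → ℝ) :
    M.res (V := F.c.dom F.V₀) le_top ((F.oddField d).1 (F.oddFn v)) = d v • 1 := by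
  rw [oddField, oddFn, res_liftDer_lift, oddDeriv_tmul]
  · have : CliffordAlgebra.contractLeft (Q := zeroForm n) d (ExteriorAlgebra.ι ℝ v) =
        d v • 1 := by
      rw [← Algebra.algebraMap_eq_smul_one]
      exact CliffordAlgebra.contractLeft_ι (zeroForm n) d v
    rw [this, TensorProduct.tmul_smul, ← Algebra.TensorProduct.one_def, map_smul, map_smul,
      map_one, map_one]
  · rw [oddDeriv_tmul, CliffordAlgebra.contractLeft_one, TensorProduct.tmul_zero, map_zero]

end LocalExtension

/-! ### Charts in dimension `0|n`: isolated points -/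

namespace LocalExtension

variable {n : ℕ} {M : SuperManifold.{u} 0 n} {p : M.carrier} (F : LocalExtension M p)

/-- `ℝ⁰` is a single point, already contained in the region where the cutoff is 1. Hence `lift 1` is
an idempotent, 1 on the chart domain and 0 on `O`, and multiplying by it localises to the chart. -/
lemma cutoff_eq_one : F.ρ₀ = 1 := by
  ext x
  have h : (x : E 0) ∈ F.V₀ := by
    rw [Subsingleton.elim (x : E 0) (F.c.toHomeo p)]
    exact F.mem.2
  exact congrArg (fun f => f ⟨(x : E 0), h⟩) F.one

lemma res_e_of_point (s) : M.res le_top (F.e s) = s := by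
  rw [F.res_e, F.cutoff_eq_one, ← Algebra.TensorProduct.one_def, map_one, one_mul]

lemma lift_one_mem : F.lift 1 ∈ M.gr ⊤ 0 :=
  F.lift_mem (by
    rw [Algebra.TensorProduct.one_def]
    exact tmul_mem_modelGr _
      (SetLike.GradedOne.one_mem (A := CliffordAlgebra.evenOdd (zeroForm n))))

lemma res_lift_of_point (a : Model 0 n F.c.targetOpens) :
    M.res le_top (F.lift a) = F.chartIso a := F.res_e_of_point _

lemma res_lift_one : M.res (V := F.c.dom F.c.targetOpens) le_top (F.lift 1) = 1 := by
  rw [res_lift_of_point, map_one]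

lemma lift_one_mul_eq {s t : M.Fn}
    (h : M.res (V := F.c.dom F.c.targetOpens) le_top s = M.res le_top t) :
    F.lift 1 * s = F.lift 1 * t := by
  refine eq_of_res_eq_res F.cover ?_ ?_
  · rw [map_mul, map_mul, h]
  · rw [map_mul, map_mul, lift, F.res_e', zero_mul, zero_mul]

lemma lift_one_mul_self : F.lift 1 * F.lift 1 = F.lift 1 := by
  have h := F.lift_one_mul_eq (s := F.lift 1) (t := 1) (by rw [res_lift_one, map_one])
  rwa [mul_one] at h

/-- Over a point the smooth factor consists of constants, and with at most one odd coordinate the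
exterior algebra has only constants and vectors. -/
lemma lift_one_mul (hn : n ≤ 1) (k : M.Fn) :
    ∃ (r : ℝ) (v : Fin n → ℝ), F.lift 1 * k = r • F.lift 1 + F.lift 1 * F.oddFn v := by
  have hx : F.c.toHomeo p ∈ F.c.targetOpens := F.le F.mem.2
  obtain ⟨r, v, h⟩ := exists_model_eq hn ⟨_, hx⟩ (F.chartIso.symm (M.res le_top k))
  refine ⟨r, v, ?_⟩
  rw [show r • F.lift 1 = F.lift 1 * algebraMap ℝ _ r by
    rw [← Algebra.commutes, ← Algebra.smul_def], ← mul_add]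
  refine F.lift_one_mul_eq ?_
  rw [map_add, oddFn, res_lift_of_point, AlgHom.commutes, ← F.chartIso.commutes, ← map_add, ← h,
    AlgEquiv.apply_symm_apply]

lemma dom_le_dom : F.c.dom F.c.targetOpens ≤ F.c.dom F.V₀ := by
  rintro x ⟨hx, _⟩
  refine ⟨hx, ?_⟩
  change F.c.toHomeo x ∈ F.V₀
  rw [Subsingleton.elim (F.c.toHomeo x) (F.c.toHomeo p)]
  exact F.mem.2

end LocalExtension

/-- Over a neighbourhood of each point, `g(Y, P)` vanishes if `g(Y, P) Z + (-1)^{|Y||Z|} g(Z, P) Y`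
vanishes for all homogeneous `Y` and `Z`. -/
lemma exists_res_inner_eq_zero {m n : ℕ} {M : SuperManifold.{u} m n} {g : SuperMetric M}
    {P : M.Vect} (hP : HasDeg g.deg P)
    (H : ∀ (j k : ZMod 2) (Y Z : M.Vect), HasDeg j Y → HasDeg k Z →
      g.form ⊤ Y P • Z + sgn j k • g.form ⊤ Z P • Y = 0) (Y : M.Vect) (p : M.carrier) :
    ∃ V : Opens M.carrier, p ∈ V ∧ M.res (V := V) le_top (g.form ⊤ Y P) = 0 := by
  obtain ⟨F⟩ := nonempty_localExtension M p
  refine ⟨F.c.dom F.V₀, F.mem, ?_⟩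
  rcases Nat.eq_zero_or_pos m with rfl | hm
  · by_cases hn : n ≤ 1
    · suffices h : F.lift 1 * g.form ⊤ Y P = 0 by
        have h2 := congrArg (M.res (V := F.c.dom F.V₀) le_top) h
        rw [map_mul, map_zero, ← res_res le_top F.dom_le (F.lift 1), F.res_lift_one, map_one,
          one_mul] at h2
        exact h2
      rcases Nat.le_one_iff_eq_zero_or_eq_one.1 hn with rfl | rfl
      · refine mul_form_eq_zero_of_const g.isSuperMetric F.lift_one_mem F.lift_one_mul_self ?_ Y
        intro k
        obtain ⟨r, v, h⟩ := F.lift_one_mul hn k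
        refine ⟨r, ?_⟩
        rw [h, Subsingleton.elim v 0, LocalExtension.oddFn, map_zero, TensorProduct.tmul_zero,
          LocalExtension.lift, LocalExtension.lift, map_zero, map_zero, mul_zero, add_zero]
      · let d : Module.Dual ℝ (Fin 1 → ℝ) := LinearMap.proj 0
        refine mul_form_eq_zero_of_one_odd g.isSuperMetric hP F.lift_one_mem F.lift_one_mul_self
          (D := F.oddField d) (F.hasDeg_liftDer _) (F.oddFn_mem 1) ?_ ?_ Y
        · have h1 := congrArg (M.res F.dom_le_dom) (F.res_oddField d 1)
          rw [res_res] at h1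
          have h2 := F.lift_one_mul_eq (s := (F.oddField d).1 (F.oddFn 1)) (t := 1) (by
            rw [h1, show d 1 = 1 from rfl, one_smul, map_one, map_one])
          rw [h2, mul_one]
        · intro k
          obtain ⟨r, v, h⟩ := F.lift_one_mul hn k
          refine ⟨r, v 0, ?_⟩
          have hv : v = v 0 • (1 : Fin 1 → ℝ) := by
            ext i
            rw [Subsingleton.elim i 0]
            simp
          have ho : F.oddFn v = v 0 • F.oddFn 1 := by
            rw [LocalExtension.oddFn, LocalExtension.oddFn, LocalExtension.lift,
              LocalExtension.lift, ← map_smul, ← map_smul, ← TensorProduct.tmul_smul, ← map_smul,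
              ← hv]
          rw [h, ho, mul_smul_comm]
    · let i : Fin n := ⟨0, by omega⟩
      let j : Fin n := ⟨1, by omega⟩
      -- The contractions dual to two distinct basis vectors serve as `∂/∂θⁱ` and `∂/∂θʲ`.
      have hij : i ≠ j := by simp [i, j]
      refine map_form_eq_zero_of_odd (M.res le_top) H (D := F.oddField (LinearMap.proj i))
        (D' := F.oddField (LinearMap.proj j)) (F.hasDeg_liftDer _) (F.hasDeg_liftDer _)
        (h := F.oddFn (Pi.single i 1)) (h' := F.oddFn (Pi.single j 1)) ?_ ?_ ?_ Y
      · rw [F.res_oddField]; simp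
      · rw [F.res_oddField]; simp
      · rw [F.res_oddField]; simp [hij]
  · exact map_form_eq_zero_of_even (M.res le_top) H (D := F.evenField ⟨0, hm⟩)
      (F.hasDeg_liftDer _) (F.res_evenField ⟨0, hm⟩) Y

/-- Compatibility makes `g(Y, P)` vanish locally for every `Y`, hence globally because sections are
determined locally. Non-degeneracy then gives `P = 0`. -/
lemma not_metricCompatible {m n : ℕ} {M : SuperManifold.{u} m n} {g : SuperMetric M}
    {P : M.Vect} (hP : HasDeg g.deg P) (hP0 : P ≠ 0) {D : AffineConnection M}
    (hD : D.HasNonMetricity g P) : ¬ D.MetricCompatible g := by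
  intro hD'
  refine hP0 (g.isSuperMetric.ext_right fun _ Y _ => ?_)
  rw [map_zero]
  refine eq_of_locally_res_eq fun p => ?_
  obtain ⟨V, hV, h⟩ := exists_res_inner_eq_zero hP (fun j k Y Z hY hZ =>
    smul_add_smul_eq_zero g.isSuperMetric hP hD hD' hY hZ) Y p
  exact ⟨V, hV, by rw [h, map_zero]⟩

end SuperGeometry

end

theorem theorem2p14 {m n : ℕ} (M : SuperGeometry.SuperManifold.{u} m n)
    (g : SuperGeometry.SuperMetric M) (P : M.Vect)
    (hP : SuperGeometry.SuperRingedSpace.HasDeg g.deg P) :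
    (∃! D : SuperGeometry.AffineConnection M,
      D.HasSemiSymmetricTorsion g P ∧ D.HasNonMetricity g P) ∧
    (∀ D : SuperGeometry.AffineConnection M,
      D.HasSemiSymmetricTorsion g P ∧ D.HasNonMetricity g P ↔
        D.IsSemiSymmetricNonMetric g P) ∧
    (P ≠ 0 → ∀ D : SuperGeometry.AffineConnection M,
      D.HasSemiSymmetricTorsion g P ∧ D.HasNonMetricity g P → ¬ D.MetricCompatible g) :=
  ⟨SuperGeometry.existsUnique_semiSymmetricNonMetric hP,
    SuperGeometry.isSemiSymmetricNonMetric_iff hP,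
    fun hP0 _ hD => SuperGeometry.not_metricCompatible hP hP0 hD.2⟩
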